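/- Let $\Omega\subset\mathbb{R}^3$ be a bounded domain (nonempty, open, connected) with boundary of class $C^{2,1}$. Let $H^2_N(\Omega,\mathbb{R}^3)$ be the space of all $u\in H^2(\Omega,\mathbb{R}^3)$ that satisfy the homogeneous Neumann condition $\frac{\partial u}{\partial\nu}=0$ on $\partial\Omega$ (that is, $\int_\Omega(\varphi\,\Delta u+\sum_{i}\partial_i\varphi\,\partial_i u)\,dx=0$ for all $\varphi\in H^1(\Omega)$), equipped with the $H^2$-norm. Then the set $$\mathcal{M}=\{u\in H^2_N(\Omega,\mathbb{R}^3) : |u|=1 \text{ pointwise (almost everywhere) in } \Omega\}$$ is a smooth ($C^\infty$) submanifold of $H^2_N(\Omega,\mathbb{R}^3)$: around each of its points there is a smooth diffeomorphism between open subsets of $H^2_N(\Omega,\mathbb{R}^3)$ that maps $\mathcal{M}$ to the corresponding part of a closed complemented linear subspace. Moreover, for every $u_0\in\mathcal{M}$, the tangent space of $\mathcal{M}$ at $u_0$ (the set of velocities $c'(0)$ of $C^1$ curves $c$ in $\mathcal{M}$ with $c(0)=u_0$) is $$T_{u_0}\mathcal{M}=\{u\in H^2_N(\Omega,\mathbb{R}^3)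 : u\cdot u_0=0 \text{ pointwise (almost everywhere) in } \Omega\}.$$ -/

import Mathlib

open MeasureTheory Topology Set
open scoped ContDiff

noncomputable section

/-- Three-dimensional Euclidean space. -/
abbrev Space3 : Type := EuclideanSpace ℝ (Fin 3)

/-! ### Bounded domains of class `C^{2,1}` -/

/-- Near each boundary point, and after a linear isometric change of coordinates, `Ω` is the set of
points lying strictly above the graph of a `C²` function whose second derivative is Lipschitz. -/
def HasC21Boundary (Ω : Set Space3) : Prop :=
  ∀ x ∈ frontier Ω, ∃ r : ℝ, 0 < r ∧ ∃ (e : Space3 ≃ₗᵢ[ℝ] Space3)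
    (γ : EuclideanSpace ℝ (Fin 2) → ℝ),
    ContDiff ℝ 2 γ ∧ (∃ K, LipschitzWith K (iteratedFDeriv ℝ 2 γ)) ∧
    Ω ∩ Metric.ball x r = {y ∈ Metric.ball x r | γ !₂[e y 0, e y 1] < e y 2}

/-- Bounded domains (nonempty connected open sets) of class `C^{2,1}` in `ℝ³`. -/
structure IsBoundedC21Domain (Ω : Set Space3) : Prop where
  isOpen : IsOpen Ω
  isConnected : IsConnected Ω
  isBounded : Bornology.IsBounded Ω
  hasC21Boundary : HasC21Boundary Ω

/-! ### Sobolev spaces -/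

section Sobolev

variable (Ω : Set Space3) (F : Type*) [NormedAddCommGroup F] [InnerProductSpace ℝ F]

/-- `L²(Ω, F)`, with respect to Lebesgue measure. -/
abbrev L2 : Type _ := Lp F 2 (volume.restrict Ω)

/-- `φ ∈ C_c^∞(Ω)`. -/
structure IsTestFunction (φ : Space3 → ℝ) : Prop where
  contDiff : ContDiff ℝ ∞ φ
  hasCompactSupport : HasCompactSupport φ
  tsupport_subset : tsupport φ ⊆ Ω

/-- The classical partial derivative `∂ᵢ φ`. -/
def partialDeriv (i : Fin 3) (φ : Space3 → ℝ) (x : Space3) : ℝ :=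
  fderiv ℝ φ x (EuclideanSpace.single i 1)

variable {Ω F}

/-- `g` is the weak partial derivative `∂ᵢ u` of `u` in `Ω`. -/
def HasWeakPartial (i : Fin 3) (u g : L2 Ω F) : Prop :=
  ∀ φ : Space3 → ℝ, IsTestFunction Ω φ →
    ∫ x in Ω, partialDeriv i φ x • u x = -∫ x in Ω, φ x • g x

theorem integral_smul_add_L2 {f : Space3 → ℝ} (hf : MemLp f 2 (volume.restrict Ω))
    (u v : L2 Ω F) :
    ∫ x in Ω, f x • (u + v : L2 Ω F) x = (∫ x in Ω, f x • u x) + ∫ x in Ω, f x • v x := by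
  have hu : Integrable (fun x => f x • u x) (volume.restrict Ω) :=
    memLp_one_iff_integrable.1 ((Lp.memLp u).smul hf)
  have hv : Integrable (fun x => f x • v x) (volume.restrict Ω) :=
    memLp_one_iff_integrable.1 ((Lp.memLp v).smul hf)
  rw [← integral_add hu hv]
  refine integral_congr_ae ?_
  filter_upwards [Lp.coeFn_add u v] with x hx
  rw [hx, Pi.add_apply, smul_add]

theorem integral_smul_smul_L2 (f : Space3 → ℝ) (c : ℝ) (u : L2 Ω F) :
    ∫ x in Ω, f x • (c • u : L2 Ω F) x = c • ∫ x in Ω, f x • u x := by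
  rw [← integral_smul]
  refine integral_congr_ae ?_
  filter_upwards [Lp.coeFn_smul c u] with x hx
  rw [hx, Pi.smul_apply, smul_comm]

theorem integral_smul_zero_L2 (f : Space3 → ℝ) :
    ∫ x in Ω, f x • (0 : L2 Ω F) x = 0 := by
  simpa using integral_smul_smul_L2 f 0 (0 : L2 Ω F)

theorem IsTestFunction.memLp {φ : Space3 → ℝ} (h : IsTestFunction Ω φ) :
    MemLp φ 2 (volume.restrict Ω) :=
  (h.contDiff.continuous.memLp_of_hasCompactSupport h.hasCompactSupport).restrict Ω

theorem IsTestFunction.memLp_partialDeriv {φ : Space3 → ℝ} (h : IsTestFunction Ω φ) (i : Fin 3) :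
    MemLp (partialDeriv i φ) 2 (volume.restrict Ω) := by
  refine (Continuous.memLp_of_hasCompactSupport ?_ ?_).restrict Ω
  · exact (h.contDiff.continuous_fderiv (by simp)).clm_apply continuous_const
  · exact h.hasCompactSupport.fderiv_apply ℝ (EuclideanSpace.single i 1)

theorem HasWeakPartial.add {i : Fin 3} {u g v k : L2 Ω F} (hu : HasWeakPartial i u g)
    (hv : HasWeakPartial i v k) : HasWeakPartial i (u + v) (g + k) := fun φ hφ => by
  rw [integral_smul_add_L2 (hφ.memLp_partialDeriv i), integral_smul_add_L2 hφ.memLp, hu φ hφ,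
    hv φ hφ, neg_add]

theorem HasWeakPartial.smul {i : Fin 3} {u g : L2 Ω F} (c : ℝ) (hu : HasWeakPartial i u g) :
    HasWeakPartial i (c • u) (c • g) := fun φ hφ => by
  rw [integral_smul_smul_L2, integral_smul_smul_L2, hu φ hφ, smul_neg]

theorem hasWeakPartial_zero (i : Fin 3) : HasWeakPartial i (0 : L2 Ω F) 0 := fun φ _ => by
  rw [integral_smul_zero_L2, integral_smul_zero_L2, neg_zero]

/-- The indices of the partial derivatives of order at most one: `inl ()` stands for the function
itself, `inr i` for `∂ᵢ`. -/
abbrev Index1 : Type := Unit ⊕ Fin 3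

/-- The indices of the partial derivatives of order at most two: `inl a` stands for those of order
at most one, `inr (i, j)` for `∂ⱼ ∂ᵢ`. -/
abbrev Index2 : Type := Index1 ⊕ (Fin 3 × Fin 3)

variable (Ω F)

/-- The Sobolev space `H¹(Ω, F)`. A function `u ∈ L²(Ω, F)` with weak first derivatives in `L²` is
recorded together with these (uniquely determined) derivatives, so that the inner product inherited
from the `ℓ²`-sum is `⟨u, v⟩ + ∑ᵢ ⟨∂ᵢ u, ∂ᵢ v⟩`. -/
def H1 : Submodule ℝ (PiLp 2 fun _ : Index1 => L2 Ω F) where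
  carrier := {U | ∀ i, HasWeakPartial i (U (.inl ())) (U (.inr i))}
  add_mem' hU hV i := (hU i).add (hV i)
  zero_mem' i := hasWeakPartial_zero i
  smul_mem' c _ hU i := (hU i).smul c

/-- The Sobolev space `H²(Ω, F)`, in the same way; its inner product is
`⟨u, v⟩ + ∑ᵢ ⟨∂ᵢ u, ∂ᵢ v⟩ + ∑ᵢⱼ ⟨∂ⱼ ∂ᵢ u, ∂ⱼ ∂ᵢ v⟩`. -/
def H2 : Submodule ℝ (PiLp 2 fun _ : Index2 => L2 Ω F) where
  carrier := {U | (∀ i, HasWeakPartial i (U (.inl (.inl ()))) (U (.inl (.inr i)))) ∧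
    ∀ i j, HasWeakPartial j (U (.inl (.inr i))) (U (.inr (i, j)))}
  add_mem' hU hV := ⟨fun i => (hU.1 i).add (hV.1 i), fun i j => (hU.2 i j).add (hV.2 i j)⟩
  zero_mem' := ⟨fun i => hasWeakPartial_zero i, fun _ j => hasWeakPartial_zero j⟩
  smul_mem' c _ hU := ⟨fun i => (hU.1 i).smul c, fun i j => (hU.2 i j).smul c⟩

variable {Ω F}

/-- The function `u ∈ L²` underlying an element of `H¹`. -/
def H1.val (u : H1 Ω F) : L2 Ω F := u.1 (.inl ())

/-- The weak derivative `∂ᵢ u` of `u ∈ H¹`. -/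
def H1.deriv (u : H1 Ω F) (i : Fin 3) : L2 Ω F := u.1 (.inr i)

/-- The function `u ∈ L²` underlying an element of `H²`. -/
def H2.val (u : H2 Ω F) : L2 Ω F := u.1 (.inl (.inl ()))

/-- The weak derivative `∂ᵢ u` of `u ∈ H²`. -/
def H2.deriv (u : H2 Ω F) (i : Fin 3) : L2 Ω F := u.1 (.inl (.inr i))

/-- The weak derivative `∂ⱼ ∂ᵢ u` of `u ∈ H²`. -/
def H2.deriv₂ (u : H2 Ω F) (i j : Fin 3) : L2 Ω F := u.1 (.inr (i, j))

/-- The normal derivative `∂u/∂ν` on `∂Ω` of `u ∈ H²(Ω, F)`, as a functional on `H¹(Ω)`: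
`⟨∂u/∂ν, φ⟩ = ∫_Ω (φ Δu + ∇φ · ∇u) dx`, which is `∫_{∂Ω} φ ∂u/∂ν dS` by Green's formula. -/
def normalDerivative (u : H2 Ω F) (φ : H1 Ω ℝ) : F :=
  ∑ i : Fin 3, ((∫ x in Ω, H1.val φ x • H2.deriv₂ u i i x) +
    ∫ x in Ω, H1.deriv φ i x • H2.deriv u i x)

theorem normalDerivative_add (u v : H2 Ω F) (φ : H1 Ω ℝ) :
    normalDerivative (u + v) φ = normalDerivative u φ + normalDerivative v φ := by
  unfold normalDerivative
  rw [← Finset.sum_add_distrib]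
  refine Finset.sum_congr rfl fun i _ => ?_
  have h1 : H2.deriv₂ (u + v) i i = H2.deriv₂ u i i + H2.deriv₂ v i i := rfl
  have h2 : H2.deriv (u + v) i = H2.deriv u i + H2.deriv v i := rfl
  rw [h1, h2, integral_smul_add_L2 (Lp.memLp _), integral_smul_add_L2 (Lp.memLp _)]
  abel

theorem normalDerivative_smul (c : ℝ) (u : H2 Ω F) (φ : H1 Ω ℝ) :
    normalDerivative (c • u) φ = c • normalDerivative u φ := by
  unfold normalDerivative
  rw [Finset.smul_sum]
  refine Finset.sum_congr rfl fun i _ => ?_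
  have h1 : H2.deriv₂ (c • u) i i = c • H2.deriv₂ u i i := rfl
  have h2 : H2.deriv (c • u) i = c • H2.deriv u i := rfl
  rw [h1, h2, integral_smul_smul_L2, integral_smul_smul_L2, smul_add]

variable (Ω F)

/-- The space `H²_N(Ω, F)` of all `u ∈ H²(Ω, F)` with `∂u/∂ν = 0` on `∂Ω`, with the `H²` norm. -/
def H2N : Submodule ℝ (H2 Ω F) where
  carrier := {u | ∀ φ : H1 Ω ℝ, normalDerivative u φ = 0}
  add_mem' hu hv φ := by rw [normalDerivative_add, hu φ, hv φ, add_zero]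
  zero_mem' φ := by simpa using normalDerivative_smul 0 (0 : H2 Ω F) φ
  smul_mem' c u hu φ := by rw [normalDerivative_smul, hu φ, smul_zero]

variable {Ω F}

/-- The function `u ∈ L²` underlying an element of `H²_N`. -/
def H2N.val (u : H2N Ω F) : L2 Ω F := H2.val u.1

end Sobolev

/-! ### Submanifolds of normed spaces and their tangent spaces -/

section Submanifold

variable {E : Type*} [NormedAddCommGroup E] [NormedSpace ℝ E]

/-- `M` is a smooth submanifold of `E`: around each of its points there is a smooth diffeomorphism
between open subsets of `E` that takes `M` to a closed complemented linear subspace. -/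
def IsSmoothSubmanifold (M : Set E) : Prop :=
  ∀ p ∈ M, ∃ (V : Submodule ℝ E) (Φ : OpenPartialHomeomorph E E),
    IsClosed (V : Set E) ∧ V.ClosedComplemented ∧ p ∈ Φ.source ∧
    ContDiffOn ℝ ∞ Φ Φ.source ∧ ContDiffOn ℝ ∞ Φ.symm Φ.target ∧
    Φ '' (Φ.source ∩ M) = Φ.target ∩ (V : Set E)

/-- The tangent space of `M` at `p`: the velocities at time `0` of the `C¹` curves in `M` that pass
through `p` at time `0`. -/
def tangentSpaceAt (M : Set E) (p : E) : Set E :=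
  {v | ∃ c : ℝ → E, c 0 = p ∧ (∀ᶠ t in 𝓝 0, c t ∈ M) ∧ ContDiffAt ℝ 1 c 0 ∧ HasDerivAt c v 0}

end Submanifold

/-- The set of all `u ∈ H²_N(Ω, ℝ³)` with `|u| = 1` pointwise (almost everywhere). -/
def unitMaps (Ω : Set Space3) : Set (H2N Ω Space3) :=
  {u | ∀ᵐ x ∂volume.restrict Ω, ‖H2N.val u x‖ = 1}

end

/-! In three dimensions `H²` embeds into `L^∞` and into `W^{1,4}`, so it is closed under pointwise
products: in a second derivative of a product, each term is either an `L²` function times a bounded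
one or a product of two `L⁴` functions. By the product rule, `∂(uv)/∂ν` vanishes when `∂u/∂ν` and
`∂v/∂ν` do. Hence `u · v` and `a u` (`a` scalar) are bounded bilinear maps on the spaces `H²_N`
(`IsBoundedC21Domain.exists_H2N_boundedBilin`).

The rest is algebra. For a unit map `u₀`, the set of unit maps is the quadric `u · u = u₀ · u₀`. The
polynomial map `Ψ(u) = u - (u · u₀) u₀ + ½ (u · u - u₀ · u₀) u₀` has the identity as its derivative
at `u₀`, and `Ψ(u) · u₀ = ½ (u · u - u₀ · u₀)`. By the inverse function theorem `Ψ` is a chart near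
`u₀` that carries the quadric to the closed subspace `{v | v · u₀ = 0}`, which is complemented by
the pointwise projection. The tangent space is read off from the same chart
(`submanifold_of_boundedBilin`).

The embeddings come from a cone condition. If `x + t z` stays in `Ω` for `z` in a ball and `0 ≤ t ≤
1`, then `f(x)` is `f(x + z)` minus an integral of `∇f` along the segment. Averaging over `z` bounds
`f` by integrals over a cone (`IsWeakGradient.ae_enorm_le`), and weighted Cauchy–Schwarz estimates
for these give `W^{1,2} ⊆ L⁴` and `W^{1,4} ⊆ L^∞`; compactness of the closure of `Ω` makes the
bounds global. The product rule for weak derivatives (`IsWeakPartial.bilin`) is proved by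
translating one factor by `z`, mollifying in `z`, and letting continuity decide the value at `z =
0`. -/

noncomputable section

/-! ### Quadrics in Banach spaces: chart and tangent space. -/

section QuadricSubmanifold

variable {E A : Type*} [NormedAddCommGroup E] [NormedSpace ℝ E]
  [NormedAddCommGroup A] [NormedSpace ℝ A]

/-- A smooth map with invertible derivative at `p` restricts to a smooth diffeomorphism between
open sets, the source being a neighbourhood of `p`. -/
theorem exists_smooth_openPartialHomeomorph [CompleteSpace E] {f : E → E} (hf : ContDiff ℝ ∞ f) {p : E}
    (f' : E ≃L[ℝ] E) (hp : HasFDerivAt f (f' : E →L[ℝ] E) p) :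
    ∃ Φ : OpenPartialHomeomorph E E, (∀ x, Φ x = f x) ∧ p ∈ Φ.source ∧
      ContDiffOn ℝ ∞ Φ Φ.source ∧ ContDiffOn ℝ ∞ Φ.symm Φ.target := by
  set Φ₀ := hf.contDiffAt.toOpenPartialHomeomorph f hp (by simp) with hΦ₀
  have hcoe : ∀ x, Φ₀ x = f x := fun x => rfl
  -- The inverse is smooth at the image of every point where the derivative is invertible. Such
  -- points form an open set, and restricting to it makes the inverse smooth on the whole target.
  have hopen : IsOpen {x | fderiv ℝ f x ∈ range ((↑) : (E ≃L[ℝ] E) → E →L[ℝ] E)} :=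
    (ContinuousLinearEquiv.isOpen (E := E) (F := E)).preimage (hf.continuous_fderiv (by simp))
  refine ⟨Φ₀.restrOpen _ hopen, hcoe, ?_, hf.contDiffOn, ?_⟩
  · rw [OpenPartialHomeomorph.restrOpen_source]
    exact ⟨hf.contDiffAt.mem_toOpenPartialHomeomorph_source hp (by simp), f', hp.fderiv.symm⟩
  · intro y hy
    have hy' := (Φ₀.restrOpen _ hopen).map_target hy
    rw [OpenPartialHomeomorph.restrOpen_source] at hy'
    obtain ⟨g', hg'⟩ := hy'.2
    refine ((Φ₀.restrOpen _ hopen).contDiffAt_symm (f₀' := g') hy ?_ ?_).contDiffWithinAt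
    · rw [hg']
      exact (hf.differentiable (by simp) _).hasFDerivAt
    · exact hf.contDiffAt

variable (dot : E →L[ℝ] E →L[ℝ] A) (act : A →L[ℝ] E →L[ℝ] E) (u₀ : E)

/-- The map `u ↦ u - (u · u₀) u₀ + ½ (u · u - u₀ · u₀) u₀`, which flattens the quadric
`{u | u · u = u₀ · u₀}` near `u₀`. -/
def quadricChart (u : E) : E :=
  u - act (dot u u₀) u₀ + (1 / 2 : ℝ) • act (dot u u - dot u₀ u₀) u₀

theorem contDiff_quadricChart : ContDiff ℝ ∞ (quadricChart dot act u₀) := by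
  unfold quadricChart
  have h1 : ContDiff ℝ ∞ fun u => act (dot u u₀) u₀ :=
    (act.contDiff.comp ((dot.contDiff).clm_apply contDiff_const)).clm_apply contDiff_const
  have h2 : ContDiff ℝ ∞ fun u => act (dot u u - dot u₀ u₀) u₀ :=
    (act.contDiff.comp (((dot.contDiff).clm_apply contDiff_id).sub contDiff_const)).clm_apply
      contDiff_const
  exact (contDiff_id.sub h1).add (h2.const_smul _)

variable {dot act u₀}

/-- By symmetry `½ u · u` has derivative `v ↦ v · u₀` at `u₀`, which cancels the derivative of the
term `-(u · u₀) u₀`. This fixes the factor `½`. -/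
theorem hasFDerivAt_quadricChart (hsymm : ∀ u v, dot u v = dot v u) :
    HasFDerivAt (quadricChart dot act u₀)
      ((ContinuousLinearEquiv.refl ℝ E : E ≃L[ℝ] E) : E →L[ℝ] E) u₀ := by
  have h0 : HasFDerivAt (fun u => dot u u) ((2 : ℝ) • dot.flip u₀) u₀ := by
    have := dot.hasFDerivAt (x := u₀) |>.clm_apply (hasFDerivAt_id u₀)
    refine this.congr_fderiv ?_
    ext v
    simp [two_smul, hsymm v u₀]
  have h1 : HasFDerivAt (fun u => act (dot u u₀) u₀) ((act.flip u₀).comp (dot.flip u₀)) u₀ :=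
    ((act.flip u₀).comp (dot.flip u₀)).hasFDerivAt
  have h2 : HasFDerivAt (fun u => act (dot u u - dot u₀ u₀) u₀)
      ((act.flip u₀).comp ((2 : ℝ) • dot.flip u₀)) u₀ :=
    (act.flip u₀).hasFDerivAt.comp u₀ (h0.sub_const _)
  have h3 := ((hasFDerivAt_id (𝕜 := ℝ) u₀).sub h1).add (h2.const_smul (1 / 2 : ℝ))
  refine h3.congr_fderiv ?_
  ext v
  simp [smul_smul]

/-- Since `(a u₀) · u₀ = a`, pairing the chart with `u₀` cancels the linear terms and leaves `½ (u ·
u - u₀ · u₀)`. The identity is global, not only near `u₀`. -/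
theorem quadricChart_mem_ker_iff (hact : ∀ a, dot (act a u₀) u₀ = a) (u : E) :
    dot (quadricChart dot act u₀ u) u₀ = 0 ↔ dot u u = dot u₀ u₀ := by
  have : dot (quadricChart dot act u₀ u) u₀ = (1 / 2 : ℝ) • (dot u u - dot u₀ u₀) := by
    simp [quadricChart, hact]
  rw [this, smul_eq_zero, sub_eq_zero]
  norm_num

theorem quadricChart_self (hone : act (dot u₀ u₀) u₀ = u₀) : quadricChart dot act u₀ u₀ = 0 := by
  simp [quadricChart, hone]

/-- The projection `u ↦ u - (u · u₀) u₀` shows that `{u | u · u₀ = 0}` is complemented. -/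
theorem closedComplemented_ker_dot (hact : ∀ a, dot (act a u₀) u₀ = a) :
    (LinearMap.ker (dot.flip u₀ : E →ₗ[ℝ] A)).ClosedComplemented := by
  refine ⟨(ContinuousLinearMap.id ℝ E - (act.flip u₀).comp (dot.flip u₀)).codRestrict _ ?_, ?_⟩
  · intro u
    simp [hact]
  · rintro ⟨u, hu⟩
    ext
    have hu' : dot u u₀ = 0 := hu
    simp [hu']

/-- A set that coincides with a quadric `{u | u · u = u₀ · u₀}`, for each of its points `u₀`, is a
submanifold. -/
theorem isSmoothSubmanifold_quadric [CompleteSpace E] {M : Set E} (hsymm : ∀ u v, dot u v = dot v u)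
    (hM : ∀ u₀ ∈ M, (∀ u, u ∈ M ↔ dot u u = dot u₀ u₀) ∧ (∀ a, dot (act a u₀) u₀ = a) ∧
      act (dot u₀ u₀) u₀ = u₀) : IsSmoothSubmanifold M := by
  intro p hp
  obtain ⟨hMp, hact, -⟩ := hM p hp
  obtain ⟨Φ, hΦ, hps, hs, ht⟩ := exists_smooth_openPartialHomeomorph
    (contDiff_quadricChart dot act p) _ (hasFDerivAt_quadricChart hsymm)
  refine ⟨LinearMap.ker (dot.flip p : E →ₗ[ℝ] A), Φ, (dot.flip p).isClosed_ker,
    closedComplemented_ker_dot hact, hps, hs, ht, ?_⟩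
  have key : ∀ u, Φ u ∈ LinearMap.ker (dot.flip p : E →ₗ[ℝ] A) ↔ u ∈ M := fun u => by
    rw [hMp, ← quadricChart_mem_ker_iff hact, ← hΦ]
    rfl
  ext y
  constructor
  · rintro ⟨u, ⟨hu, huM⟩, rfl⟩
    exact ⟨Φ.map_source hu, (key u).2 huM⟩
  · rintro ⟨hy, hyV⟩
    refine ⟨Φ.symm y, ⟨Φ.map_target hy, (key _).1 ?_⟩, Φ.right_inv hy⟩
    rw [Φ.right_inv hy]
    exact hyV

/-- The chart `Ψ` has the identity as derivative at `u₀`. Along a curve in `M` the function `Ψ(c(t))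
· u₀` vanishes near `t = 0`, and its derivative there is `v · u₀`. Conversely, `t ↦ Ψ⁻¹(t v)` is a
curve in `M` with velocity `v`. -/
theorem tangentSpaceAt_quadric [CompleteSpace E] {M : Set E} (hsymm : ∀ u v, dot u v = dot v u)
    (hMu : ∀ u, u ∈ M ↔ dot u u = dot u₀ u₀) (hact : ∀ a, dot (act a u₀) u₀ = a)
    (hone : act (dot u₀ u₀) u₀ = u₀) :
    tangentSpaceAt M u₀ = {u | dot u u₀ = 0} := by
  have hderiv := hasFDerivAt_quadricChart (dot := dot) (act := act) (u₀ := u₀) hsymm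
  ext v
  constructor
  · rintro ⟨c, hc0, hcM, -, hc⟩
    have h1 : HasDerivAt (fun t => dot.flip u₀ (quadricChart dot act u₀ (c t)))
        (dot.flip u₀ v) 0 := by
      rw [← hc0] at hderiv
      have := hderiv.comp_hasDerivAt (0 : ℝ) hc
      rw [hc0] at this
      exact (dot.flip u₀).hasFDerivAt.comp_hasDerivAt (0 : ℝ) this
    have h2 : (fun t => dot.flip u₀ (quadricChart dot act u₀ (c t))) =ᶠ[𝓝 0] fun _ => 0 := by
      filter_upwards [hcM] with t ht
      exact (quadricChart_mem_ker_iff hact _).2 ((hMu _).1 ht)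
    exact h1.unique ((hasDerivAt_const (0 : ℝ) (0 : A)).congr_of_eventuallyEq h2)
  · intro hv
    obtain ⟨Φ, hΦ, hps, -, ht⟩ := exists_smooth_openPartialHomeomorph
      (contDiff_quadricChart dot act u₀) _ hderiv
    have hΦ0 : Φ u₀ = 0 := by rw [hΦ, quadricChart_self hone]
    have h0 : (0 : E) ∈ Φ.target := hΦ0 ▸ Φ.map_source hps
    have hsymm0 : Φ.symm 0 = u₀ := by rw [← hΦ0, Φ.left_inv hps]
    have hlin : ContDiff ℝ ∞ fun t : ℝ => t • v := contDiff_id.smul contDiff_const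
    have hΦs : ContDiffAt ℝ ∞ Φ.symm ((0 : ℝ) • v) := by
      rw [zero_smul]
      exact ht.contDiffAt (Φ.open_target.mem_nhds h0)
    refine ⟨fun t => Φ.symm (t • v), by simpa using hsymm0, ?_, ?_, ?_⟩
    · have hmem : ∀ᶠ t : ℝ in 𝓝 0, t • v ∈ Φ.target := by
        refine hlin.continuous.continuousAt.eventually_mem (Φ.open_target.mem_nhds ?_)
        simpa using h0
      filter_upwards [hmem] with t ht
      rw [hMu, ← quadricChart_mem_ker_iff hact, ← hΦ, Φ.right_inv ht]
      simp [show dot v u₀ = 0 from hv]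
    · exact (hΦs.comp (0 : ℝ) hlin.contDiffAt).of_le (by exact_mod_cast le_top)
    · have h1 : HasFDerivAt Φ.symm
          (((ContinuousLinearEquiv.refl ℝ E).symm : E ≃L[ℝ] E) : E →L[ℝ] E) ((0 : ℝ) • v) := by
        rw [zero_smul]
        refine Φ.hasFDerivAt_symm h0 ?_
        rw [hsymm0]
        exact hderiv.congr_of_eventuallyEq (Filter.Eventually.of_forall hΦ)
      have h2 : HasDerivAt (fun t : ℝ => t • v) v 0 := by
        simpa using (hasDerivAt_id (0 : ℝ)).smul_const v
      exact h1.comp_hasDerivAt (0 : ℝ) h2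

/-- A bounded bilinear map between normed spaces. -/
structure IsBoundedBilin {E₁ E₂ E₃ : Type*} [NormedAddCommGroup E₁] [NormedSpace ℝ E₁]
    [NormedAddCommGroup E₂] [NormedSpace ℝ E₂] [NormedAddCommGroup E₃] [NormedSpace ℝ E₃]
    (m : E₁ → E₂ → E₃) : Prop where
  add_left : ∀ u u' v, m (u + u') v = m u v + m u' v
  smul_left : ∀ (c : ℝ) u v, m (c • u) v = c • m u v
  add_right : ∀ u v v', m u (v + v') = m u v + m u v'
  smul_right : ∀ (c : ℝ) u v, m u (c • v) = c • m u v
  bound : ∃ K : ℝ, ∀ u v, ‖m u v‖ ≤ K * ‖u‖ * ‖v‖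

theorem IsBoundedBilin.exists_continuousLinearMap {E₁ E₂ E₃ : Type*} [NormedAddCommGroup E₁]
    [NormedSpace ℝ E₁] [NormedAddCommGroup E₂] [NormedSpace ℝ E₂] [NormedAddCommGroup E₃]
    [NormedSpace ℝ E₃] {m : E₁ → E₂ → E₃} (h : IsBoundedBilin m) :
    ∃ T : E₁ →L[ℝ] E₂ →L[ℝ] E₃, (fun u v => T u v) = m := by
  obtain ⟨K, hK⟩ := h.bound
  exact ⟨(LinearMap.mk₂ ℝ m h.add_left h.smul_left h.add_right h.smul_right).mkContinuous₂ K hK,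
    rfl⟩

theorem submanifold_of_boundedBilin [CompleteSpace E] {dot : E → E → A} {act : A → E → E}
    (hdot : IsBoundedBilin dot) (hact : IsBoundedBilin act) {M : Set E}
    (hsymm : ∀ u v, dot u v = dot v u)
    (hM : ∀ u₀ ∈ M, (∀ u, u ∈ M ↔ dot u u = dot u₀ u₀) ∧ (∀ a, dot (act a u₀) u₀ = a) ∧
      act (dot u₀ u₀) u₀ = u₀) :
    IsSmoothSubmanifold M ∧ ∀ u₀ ∈ M, tangentSpaceAt M u₀ = {u | dot u u₀ = 0} := by
  obtain ⟨D, rfl⟩ := hdot.exists_continuousLinearMap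
  obtain ⟨T, rfl⟩ := hact.exists_continuousLinearMap
  refine ⟨isSmoothSubmanifold_quadric hsymm hM, fun u₀ hu₀ => ?_⟩
  obtain ⟨h1, h2, h3⟩ := hM u₀ hu₀
  exact tangentSpaceAt_quadric hsymm h1 h2 h3

end QuadricSubmanifold

/-! ### Increments of weakly differentiable functions along segments. -/

section WeakDerivative

variable {Ω : Set Space3} {F : Type*} [NormedAddCommGroup F] [NormedSpace ℝ F]

/-- `g` is the weak partial derivative `∂ᵢ f` of `f` in `Ω`, for functions on the whole space. -/
def IsWeakPartial (Ω : Set Space3) (i : Fin 3) (f g : Space3 → F) : Prop :=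
  ∀ φ : Space3 → ℝ, IsTestFunction Ω φ → ∫ x, partialDeriv i φ x • f x = -∫ x, φ x • g x

theorem fderiv_apply_eq_sum_partialDeriv (φ : Space3 → ℝ) (x z : Space3) :
    fderiv ℝ φ x z = ∑ i, z i * partialDeriv i φ x := by
  conv_lhs => rw [← (EuclideanSpace.basisFun (Fin 3) ℝ).sum_repr z]
  simp [partialDeriv]

theorem IsTestFunction.integrable_smul {φ : Space3 → ℝ} (hφ : IsTestFunction Ω φ)
    {f : Space3 → F} (hf : Integrable f) : Integrable fun x => φ x • f x := by
  obtain ⟨C, hC⟩ := hφ.contDiff.continuous.bounded_above_of_compact_support hφ.hasCompactSupport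
  exact hf.bdd_smul C hφ.contDiff.continuous.aestronglyMeasurable (.of_forall hC)

theorem IsTestFunction.continuous_partialDeriv {φ : Space3 → ℝ} (hφ : IsTestFunction Ω φ)
    (i : Fin 3) : Continuous (partialDeriv i φ) :=
  (hφ.contDiff.continuous_fderiv (by simp)).clm_apply continuous_const

theorem IsTestFunction.hasCompactSupport_partialDeriv {φ : Space3 → ℝ} (hφ : IsTestFunction Ω φ)
    (i : Fin 3) : HasCompactSupport (partialDeriv i φ) :=
  hφ.hasCompactSupport.fderiv_apply ℝ (EuclideanSpace.single i 1)

theorem IsTestFunction.integrable_partialDeriv_smul {φ : Space3 → ℝ} (hφ : IsTestFunction Ω φ)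
    (i : Fin 3) {f : Space3 → F} (hf : Integrable f) :
    Integrable fun x => partialDeriv i φ x • f x := by
  obtain ⟨C, hC⟩ := (hφ.continuous_partialDeriv i).bounded_above_of_compact_support
    (hφ.hasCompactSupport_partialDeriv i)
  exact hf.bdd_smul C (hφ.continuous_partialDeriv i).aestronglyMeasurable (.of_forall hC)

/-- The average of the translates of `φ` along the segment from `0` to `z`. -/
def segmentAverage (z : Space3) (φ : Space3 → ℝ) (y : Space3) : ℝ :=
  ∫ t in (0 : ℝ)..1, φ (y - t • z)

/-- The average is the convolution of `φ` with a finite measure, the image of Lebesgue measure on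
`(0, 1]` under `t ↦ t z`. -/
theorem contDiff_segmentAverage (z : Space3) {φ : Space3 → ℝ} (hφ : ContDiff ℝ ∞ φ)
    (hc : HasCompactSupport φ) : ContDiff ℝ ∞ (segmentAverage z φ) := by
  have hm : Measurable fun t : ℝ => t • z := by fun_prop
  have : segmentAverage z φ = convolution (fun _ => (1 : ℝ)) φ (ContinuousLinearMap.mul ℝ ℝ)
      ((volume.restrict (Ioc (0 : ℝ) 1)).map fun t : ℝ => t • z) := by
    ext y
    rw [segmentAverage, intervalIntegral.integral_of_le zero_le_one, convolution_def,
      integral_map hm.aemeasurable]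
    · simp
    · exact ((ContinuousLinearMap.mul ℝ ℝ 1).continuous.comp
        (hφ.continuous.comp (continuous_const.sub continuous_id))).aestronglyMeasurable
  rw [this]
  exact hc.contDiff_convolution_right _ (integrable_const _).locallyIntegrable hφ

/-- The support lies in the set swept out by `tsupport φ` moving along the segment, which is compact
and contained in `Ω`. -/
theorem isTestFunction_segmentAverage {U : Set Space3} {z : Space3} {φ : Space3 → ℝ}
    (hz : ∀ x ∈ U, ∀ t ∈ Icc (0 : ℝ) 1, x + t • z ∈ Ω) (hφ : IsTestFunction U φ) :
    IsTestFunction Ω (segmentAverage z φ) := by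
  have hK : IsCompact ((fun p : ℝ × Space3 => p.2 + p.1 • z) '' (Icc (0 : ℝ) 1 ×ˢ tsupport φ)) :=
    (isCompact_Icc.prod hφ.hasCompactSupport).image (by fun_prop)
  have hsub : Function.support (segmentAverage z φ) ⊆
      (fun p : ℝ × Space3 => p.2 + p.1 • z) '' (Icc (0 : ℝ) 1 ×ˢ tsupport φ) := by
    intro y hy
    by_contra hcon
    refine hy ?_
    rw [segmentAverage, intervalIntegral.integral_of_le zero_le_one]
    refine setIntegral_eq_zero_of_forall_eq_zero fun t ht => ?_
    by_contra hne
    exact hcon ⟨(t, y - t • z), ⟨⟨ht.1.le, ht.2⟩, subset_tsupport _ hne⟩, by simp⟩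
  refine ⟨contDiff_segmentAverage z hφ.contDiff hφ.hasCompactSupport,
    HasCompactSupport.of_support_subset_isCompact hK hsub, ?_⟩
  refine (closure_minimal hsub hK.isClosed).trans ?_
  rintro _ ⟨⟨t, x⟩, ⟨ht, hx⟩, rfl⟩
  exact hz x (hφ.tsupport_subset hx) t ht

/-- On the line `s ↦ y + s z` the average is the integral of `ψ` over `[s - 1, s]`, so the
fundamental theorem of calculus gives its derivative. -/
theorem fderiv_segmentAverage (z : Space3) {φ : Space3 → ℝ} (hφ : ContDiff ℝ ∞ φ)
    (hc : HasCompactSupport φ) (y : Space3) :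
    fderiv ℝ (segmentAverage z φ) y z = φ y - φ (y - z) := by
  set ψ : ℝ → ℝ := fun s => φ (y + s • z) with hψ
  have hψc : Continuous ψ := hφ.continuous.comp (by fun_prop)
  have h1 : HasDerivAt (fun s : ℝ => segmentAverage z φ (y + s • z))
      (fderiv ℝ (segmentAverage z φ) y z) 0 := by
    have h2 : HasDerivAt (fun s : ℝ => y + s • z) z 0 := by
      simpa using ((hasDerivAt_id (0 : ℝ)).smul_const z).const_add y
    have h3 : HasFDerivAt (segmentAverage z φ) (fderiv ℝ (segmentAverage z φ) y)
        (y + (0 : ℝ) • z) := by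
      rw [zero_smul, add_zero]
      exact ((contDiff_segmentAverage z hφ hc).differentiable (by simp) y).hasFDerivAt
    exact h3.comp_hasDerivAt (0 : ℝ) h2
  have h4 : (fun s : ℝ => segmentAverage z φ (y + s • z)) =
      fun s => (∫ τ in (0 : ℝ)..s, ψ τ) - ∫ τ in (0 : ℝ)..(s - 1), ψ τ := by
    ext s
    rw [intervalIntegral.integral_interval_sub_left (hψc.intervalIntegrable _ _)
      (hψc.intervalIntegrable _ _), segmentAverage]
    have := intervalIntegral.integral_comp_sub_left (a := 0) (b := 1) ψ s
    rw [sub_zero] at this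
    rw [← this]
    refine intervalIntegral.integral_congr fun t _ => ?_
    simp only [hψ, sub_smul]
    congr 1
    abel
  have h5 : HasDerivAt (fun s => (∫ τ in (0 : ℝ)..s, ψ τ) - ∫ τ in (0 : ℝ)..(s - 1), ψ τ)
      (ψ 0 - ψ (-1)) 0 := by
    have h6 := hψc.integral_hasStrictDerivAt 0 0
    have h7 := hψc.integral_hasStrictDerivAt 0 ((0 : ℝ) - 1)
    have h8 : HasDerivAt (fun s : ℝ => ∫ τ in (0 : ℝ)..(s - 1), ψ τ) (ψ (0 - 1)) 0 := by
      have := h7.hasDerivAt.comp (0 : ℝ) ((hasDerivAt_id (0 : ℝ)).sub_const 1)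
      rwa [mul_one] at this
    rw [zero_sub] at h8
    exact h6.hasDerivAt.sub h8
  rw [h4] at h1
  rw [h1.unique h5]
  simp [hψ, sub_eq_add_neg]

/-- The shear `(t, x) ↦ (t, x + t z)` preserves the product measure. -/
theorem measurePreserving_shear (ν : Measure ℝ) [SFinite ν] (z : Space3) :
    MeasurePreserving (fun p : ℝ × Space3 => (p.1, p.2 + p.1 • z)) (ν.prod volume)
      (ν.prod volume) :=
  (MeasurePreserving.id ν).skew_product (g := fun (t : ℝ) (x : Space3) => x + t • z)
    (by unfold Function.uncurry; fun_prop)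
    (.of_forall fun t => (measurePreserving_add_right volume (t • z)).map_eq)

theorem integrable_comp_shear {F : Type*} [NormedAddCommGroup F] {G : Space3 → F} (hG : Integrable G) (z : Space3) :
    Integrable (fun p : ℝ × Space3 => G (p.2 + p.1 • z))
      ((volume.restrict (Ioc (0 : ℝ) 1)).prod volume) :=
  (measurePreserving_shear (volume.restrict (Ioc (0 : ℝ) 1)) z).integrable_comp_of_integrable
    (g := fun p : ℝ × Space3 => G p.2) (hG.comp_snd _)

/-- Increments of a weakly differentiable function are integrals of its gradient. -/
theorem ae_sub_eq_integral_of_isWeakPartial [CompleteSpace F] {U : Set Space3} (hU : IsOpen U)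
    {z : Space3} (hz : ∀ x ∈ U, ∀ t ∈ Icc (0 : ℝ) 1, x + t • z ∈ Ω) {f : Space3 → F}
    {g : Fin 3 → Space3 → F} (hf : Integrable f) (hg : ∀ i, Integrable (g i))
    (h : ∀ i, IsWeakPartial Ω i f (g i)) :
    ∀ᵐ x, x ∈ U → f (x + z) - f x = ∫ t in (0 : ℝ)..1, ∑ i, z i • g i (x + t • z) := by
  set G : Space3 → F := fun x => ∑ i, z i • g i x with hGdef
  have hG : Integrable G := integrable_finsetSum _ fun i _ => (hg i).smul (z i)
  have hfz : Integrable fun x => f (x + z) := hf.comp_add_right z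
  have hGs := integrable_comp_shear hG z
  have hGi : Integrable fun x => ∫ t in (0 : ℝ)..1, G (x + t • z) := by
    simp only [intervalIntegral.integral_of_le zero_le_one]
    exact hGs.integral_prod_right
  suffices H : ∀ᵐ x, x ∈ U → f (x + z) - f x - ∫ t in (0 : ℝ)..1, G (x + t • z) = 0 by
    filter_upwards [H] with x hx hxU using sub_eq_zero.1 (hx hxU)
  -- Tested with `φ`, everything moves onto `φ` by translation and Fubini: the increment of `f`
  -- becomes the pairing of `f` with `φ(y - z) - φ(y)`, the segment integral of `G` the pairing of
  -- `G` with the segment average of `φ`. The weak derivatives link the two, the segment average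
  -- having derivative `φ(y) - φ(y - z)` along `z`.
  refine hU.ae_eq_zero_of_integral_contDiff_smul_eq_zero
    (((hfz.sub hf).sub hGi).locallyIntegrable.locallyIntegrableOn U) fun φ hφ hφc hφU => ?_
  have hφt : IsTestFunction U φ := ⟨hφ, hφc, hφU⟩
  have hΦ := isTestFunction_segmentAverage hz hφt
  have h1 : ∫ y, (φ y - φ (y - z)) • f y = -∫ y, segmentAverage z φ y • G y := by
    calc ∫ y, (φ y - φ (y - z)) • f y
        = ∫ y, ∑ i, z i • partialDeriv i (segmentAverage z φ) y • f y := by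
          refine integral_congr_ae (.of_forall fun y => ?_)
          simp only
          rw [← fderiv_segmentAverage z hφ hφc, fderiv_apply_eq_sum_partialDeriv, Finset.sum_smul]
          simp [smul_smul]
      _ = ∑ i, z i • ∫ y, partialDeriv i (segmentAverage z φ) y • f y := by
          rw [integral_finsetSum]
          · simp only [integral_smul]
          · exact fun i _ => (hΦ.integrable_partialDeriv_smul i hf).smul (z i)
      _ = -∑ i, z i • ∫ y, segmentAverage z φ y • g i y := by
          rw [← Finset.sum_neg_distrib]
          exact Finset.sum_congr rfl fun i _ => by rw [h i _ hΦ, smul_neg]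
      _ = -∫ y, segmentAverage z φ y • G y := by
          simp only [hGdef, Finset.smul_sum, ← integral_smul]
          rw [integral_finsetSum]
          · exact congrArg _ (Finset.sum_congr rfl fun i _ => integral_congr_ae
              (.of_forall fun y => smul_comm _ _ _))
          · exact fun i _ => hΦ.integrable_smul ((hg i).smul (z i))
  have h2 : ∫ y, segmentAverage z φ y • G y = ∫ x, φ x • ∫ t in (0 : ℝ)..1, G (x + t • z) := by
    have e1 : ∀ y, segmentAverage z φ y • G y = ∫ t in Ioc (0 : ℝ) 1, φ (y - t • z) • G y := by
      intro y
      rw [segmentAverage, intervalIntegral.integral_of_le zero_le_one, integral_smul_const]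
    have e2 : ∀ x, φ x • ∫ t in (0 : ℝ)..1, G (x + t • z) =
        ∫ t in Ioc (0 : ℝ) 1, φ x • G (x + t • z) := by
      intro x
      rw [intervalIntegral.integral_of_le zero_le_one, integral_smul]
    have hint : Integrable (fun p : ℝ × Space3 => φ p.2 • G (p.2 + p.1 • z))
        ((volume.restrict (Ioc (0 : ℝ) 1)).prod volume) := by
      obtain ⟨C, hC⟩ := hφ.continuous.bounded_above_of_compact_support hφc
      exact hGs.bdd_smul C (hφ.continuous.comp continuous_snd).aestronglyMeasurable
        (.of_forall fun p => hC _)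
    have hint' : Integrable (fun p : ℝ × Space3 => φ (p.2 - p.1 • z) • G p.2)
        ((volume.restrict (Ioc (0 : ℝ) 1)).prod volume) := by
      obtain ⟨C, hC⟩ := hφ.continuous.bounded_above_of_compact_support hφc
      have := hφ.continuous
      refine (hG.comp_snd _).bdd_smul C
        (by fun_prop : Continuous fun p : ℝ × Space3 => φ (p.2 - p.1 • z)).aestronglyMeasurable
        (.of_forall fun p => hC _)
    simp only [e1, e2]
    rw [← integral_integral_swap (f := fun (t : ℝ) (x : Space3) => φ (x - t • z) • G x) hint',
      ← integral_integral_swap (f := fun (t : ℝ) (x : Space3) => φ x • G (x + t • z)) hint]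
    refine integral_congr_ae (.of_forall fun t => ?_)
    simp only
    rw [← integral_add_right_eq_self (fun x => φ (x - t • z) • G x) (t • z)]
    simp
  have h3 : ∫ y, φ (y - z) • f y = ∫ x, φ x • f (x + z) := by
    rw [← integral_add_right_eq_self (fun y => φ (y - z) • f y) z]
    simp
  have i1 := hφt.integrable_smul hf
  have i2 := hφt.integrable_smul hfz
  have i3 := hφt.integrable_smul hGi
  have i4 : Integrable fun y => φ (y - z) • f y := by
    have := i2.comp_sub_right z
    simpa using this
  have h4 : (∫ y, φ y • f y) - ∫ x, φ x • f (x + z) =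
      -∫ x, φ x • ∫ t in (0 : ℝ)..1, G (x + t • z) := by
    rw [← h2, ← h1, ← h3, ← integral_sub i1 i4]
    simp only [sub_smul]
  simp only [smul_sub]
  rw [integral_sub, integral_sub i2 i1]
  · rw [sub_eq_zero, ← neg_inj, neg_sub, h4]
  · exact i2.sub i1
  · exact i3

end WeakDerivative

/-! ### The cone condition for the domain. -/

section Cone

variable {Ω : Set Space3}

/-- The set `U` has cones in `Ω`: for `x ∈ U`, the cone with vertex `x` over the ball
`x + ball z₀ ρ` lies in `Ω`. -/
def HasCones (Ω U : Set Space3) (z₀ : Space3) (ρ : ℝ) : Prop :=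
  ∀ x ∈ U, ∀ z ∈ Metric.ball z₀ ρ, ∀ t ∈ Icc (0 : ℝ) 1, x + t • z ∈ Ω

theorem exists_hasCones_of_mem (hΩ : IsOpen Ω) {x₀ : Space3} (hx₀ : x₀ ∈ Ω) :
    ∃ N ∈ 𝓝 x₀, IsOpen N ∧ ∃ (z₀ : Space3) (ρ : ℝ), 0 < ρ ∧ HasCones Ω (N ∩ Ω) z₀ ρ := by
  obtain ⟨r, hr, hball⟩ := Metric.isOpen_iff.1 hΩ x₀ hx₀
  refine ⟨Metric.ball x₀ (r / 2), Metric.ball_mem_nhds _ (by positivity), Metric.isOpen_ball,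
    0, r / 2, by positivity, ?_⟩
  rintro x ⟨hx, -⟩ z hz t ht
  refine hball ?_
  rw [Metric.mem_ball, dist_eq_norm] at hx ⊢
  rw [mem_ball_zero_iff] at hz
  have h1 : ‖t • z‖ ≤ ‖z‖ := by
    rw [norm_smul, Real.norm_of_nonneg ht.1]
    exact mul_le_of_le_one_left (norm_nonneg z) ht.2
  calc ‖x + t • z - x₀‖ = ‖(x - x₀) + t • z‖ := by congr 1; abel
    _ ≤ ‖x - x₀‖ + ‖t • z‖ := norm_add_le _ _
    _ < r := by linarith

/-- The horizontal part of a vector. -/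
def horizontal (y : Space3) : EuclideanSpace ℝ (Fin 2) := !₂[y 0, y 1]

theorem horizontal_add_smul (x z : Space3) (t : ℝ) :
    horizontal (x + t • z) = horizontal x + t • horizontal z := by
  ext i
  fin_cases i <;> simp [horizontal]

theorem norm_horizontal_le (y : Space3) : ‖horizontal y‖ ≤ ‖y‖ := by
  rw [EuclideanSpace.norm_eq, EuclideanSpace.norm_eq]
  refine Real.sqrt_le_sqrt ?_
  rw [Fin.sum_univ_two, Fin.sum_univ_three]
  simp only [horizontal]
  simp
  positivity

theorem horizontal_sub (x y : Space3) : horizontal (x - y) = horizontal x - horizontal y := by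
  simpa [sub_eq_add_neg] using horizontal_add_smul x y (-1)

/-- A `C²` function is locally Lipschitz, so the graph rises no faster than `K` times the horizontal
displacement. Nearly vertical segments starting above the graph therefore stay above it. -/
theorem exists_hasCones_of_mem_frontier (hΩ : HasC21Boundary Ω) {x₀ : Space3}
    (hx₀ : x₀ ∈ frontier Ω) :
    ∃ N ∈ 𝓝 x₀, IsOpen N ∧ ∃ (z₀ : Space3) (ρ : ℝ), 0 < ρ ∧ HasCones Ω (N ∩ Ω) z₀ ρ := by
  obtain ⟨r, hr, e, γ, hγ, -, hgraph⟩ := hΩ x₀ hx₀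
  have hmem : ∀ y ∈ Metric.ball x₀ r, (y ∈ Ω ↔ γ (horizontal (e y)) < e y 2) := by
    intro y hy
    have := Set.ext_iff.1 hgraph y
    simp only [mem_inter_iff, hy, and_true, mem_ofPred_eq, true_and] at this
    exact this
  obtain ⟨K, T, hT, hK⟩ := ((hγ.of_le one_le_two).contDiffAt
    (x := horizontal (e x₀))).exists_lipschitzOnWith
  obtain ⟨s, hs, hsT⟩ := Metric.mem_nhds_iff.1 hT
  set r' := min r s with hr'
  have hr'0 : 0 < r' := lt_min hr hs
  have hK0 : (0 : ℝ) ≤ K := K.2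
  -- The cone is aimed at height `h` above its vertex. A displacement has length at most `2h =
  -- r'/2`, so from the ball of radius `r'/2` it remains within `r'`. Below, `ρ` solves `Kρ + ρ =
  -- h`: a direction has horizontal part less than `ρ` and vertical part more than `h - ρ = Kρ`.
  set h := r' / 4 with hh
  have hh0 : 0 < h := by positivity
  set ρ := h / (K + 1) with hρ
  have hρ0 : 0 < ρ := by positivity
  have hρK : (K : ℝ) * ρ + ρ = h := by rw [hρ]; field_simp
  have hρh : ρ ≤ h := by nlinarith
  refine ⟨Metric.ball x₀ (r' / 2), Metric.ball_mem_nhds _ (by positivity), Metric.isOpen_ball,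
    e.symm (h • EuclideanSpace.single 2 1), ρ, hρ0, ?_⟩
  rintro x ⟨hx, hxΩ⟩ z hz t ht
  set w := e z with hw
  have hwd : ‖w - h • EuclideanSpace.single 2 1‖ < ρ := by
    rw [Metric.mem_ball, dist_eq_norm] at hz
    rwa [← e.norm_map, map_sub, e.apply_symm_apply] at hz
  have hwh : ‖horizontal w‖ < ρ := by
    refine lt_of_le_of_lt ?_ hwd
    refine le_trans (le_of_eq ?_) (norm_horizontal_le _)
    congr 1
    rw [horizontal_sub]
    ext i
    fin_cases i <;> simp [horizontal]
  have hw2 : h - ρ < w 2 := by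
    have h1 : ‖(w - h • EuclideanSpace.single 2 1 : Space3) 2‖ ≤ _ := PiLp.norm_apply_le _ 2
    simp only [PiLp.sub_apply, PiLp.smul_apply, PiLp.single_apply, if_true, smul_eq_mul, mul_one,
      Real.norm_eq_abs] at h1
    have := (abs_lt.1 (h1.trans_lt hwd)).1
    linarith
  have hwn : ‖t • w‖ ≤ 2 * h := by
    have h1 : ‖w‖ ≤ ‖w - h • EuclideanSpace.single 2 1‖ + h := by
      calc ‖w‖ = ‖(w - h • EuclideanSpace.single 2 1) + h • EuclideanSpace.single 2 1‖ := by simp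
        _ ≤ _ := norm_add_le _ _
        _ = _ := by simp [norm_smul, hh0.le]
    rw [norm_smul, Real.norm_of_nonneg ht.1]
    calc t * ‖w‖ ≤ 1 * ‖w‖ := by gcongr; exact ht.2
      _ ≤ 2 * h := by linarith
  have hxn : ‖e x - e x₀‖ < r' / 2 := by
    rw [← map_sub, e.norm_map, ← dist_eq_norm]
    exact hx
  have hetz : e (x + t • z) = e x + t • w := by simp [hw]
  have hsum : ‖e (x + t • z) - e x₀‖ < r' := by
    calc ‖e (x + t • z) - e x₀‖ = ‖(e x - e x₀) + t • w‖ := by rw [hetz]; congr 1; abel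
      _ ≤ ‖e x - e x₀‖ + ‖t • w‖ := norm_add_le _ _
      _ < r' := by linarith
  have hball : x + t • z ∈ Metric.ball x₀ r := by
    rw [Metric.mem_ball, dist_eq_norm, ← e.norm_map, map_sub]
    exact hsum.trans_le (min_le_left _ _)
  have hT1 : ∀ y, ‖e y - e x₀‖ < r' → horizontal (e y) ∈ T := fun y hy => by
    refine hsT ?_
    rw [Metric.mem_ball, dist_eq_norm, ← horizontal_sub]
    exact (norm_horizontal_le _).trans_lt (hy.trans_le (min_le_right _ _))
  have hxT := hT1 x (by linarith)
  have hyT := hT1 _ hsum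
  have hxγ : γ (horizontal (e x)) < e x 2 := by
    refine (hmem x ?_).1 hxΩ
    rw [Metric.mem_ball] at hx ⊢
    exact hx.trans_le ((by linarith : r' / 2 ≤ r').trans (min_le_left _ _))
  rw [hmem _ hball]
  have hlip := hK.dist_le_mul _ hyT _ hxT
  have hpoint : horizontal (e (x + t • z)) = horizontal (e x) + t • horizontal w := by
    rw [hetz, horizontal_add_smul]
  rw [dist_eq_norm, dist_eq_norm, hpoint, add_sub_cancel_left, norm_smul,
    Real.norm_of_nonneg ht.1, Real.norm_eq_abs, ← hpoint] at hlip
  have hγle := (abs_le.1 hlip).2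
  have he2 : e (x + t • z) 2 = e x 2 + t * w 2 := by rw [hetz]; simp
  have h1 : (K : ℝ) * (t * ‖horizontal w‖) ≤ t * w 2 := by
    have : (K : ℝ) * ‖horizontal w‖ ≤ w 2 := by
      have := mul_le_mul_of_nonneg_left hwh.le hK0
      linarith
    calc (K : ℝ) * (t * ‖horizontal w‖) = t * (K * ‖horizontal w‖) := by ring
      _ ≤ t * w 2 := mul_le_mul_of_nonneg_left this ht.1
  rw [he2]
  linarith

theorem IsBoundedC21Domain.exists_hasCones (hΩ : IsBoundedC21Domain Ω) {x₀ : Space3}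
    (hx₀ : x₀ ∈ closure Ω) :
    ∃ N ∈ 𝓝 x₀, IsOpen N ∧ ∃ (z₀ : Space3) (ρ : ℝ), 0 < ρ ∧ HasCones Ω (N ∩ Ω) z₀ ρ := by
  by_cases h : x₀ ∈ Ω
  · exact exists_hasCones_of_mem hΩ.isOpen h
  · exact exists_hasCones_of_mem_frontier hΩ.hasC21Boundary
      ⟨hx₀, fun hi => h (interior_subset hi)⟩

end Cone

/-! ### Estimates for integrals over cones. -/

section ConeIntegrals

open scoped ENNReal

theorem ENNReal.lintegral_mul_sq_le {α : Type*} [MeasurableSpace α] (μ : Measure α)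
    {f g : α → ℝ≥0∞} (hf : AEMeasurable f μ) (hg : AEMeasurable g μ) :
    (∫⁻ a, f a * g a ∂μ) ^ 2 ≤ (∫⁻ a, f a ^ 2 ∂μ) * ∫⁻ a, g a ^ 2 ∂μ := by
  have h := ENNReal.lintegral_mul_le_Lp_mul_Lq μ Real.HolderConjugate.two_two hf hg
  have hs : ∀ x : ℝ≥0∞, (x ^ (1 / 2 : ℝ)) ^ 2 = x := fun x => by
    rw [← ENNReal.rpow_natCast, ← ENNReal.rpow_mul]
    norm_num
  calc (∫⁻ a, f a * g a ∂μ) ^ 2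
      ≤ ((∫⁻ a, f a ^ (2 : ℝ) ∂μ) ^ (1 / 2 : ℝ) * (∫⁻ a, g a ^ (2 : ℝ) ∂μ) ^ (1 / 2 : ℝ)) ^ 2 := by
        gcongr
        exact h
    _ = _ := by
        rw [mul_pow, hs, hs]
        simp only [ENNReal.rpow_two]

/-- Cauchy–Schwarz twice, with a weight. -/
theorem ENNReal.lintegral_pow_four_le {α : Type*} [MeasurableSpace α] (μ : Measure α)
    {a b F : α → ℝ≥0∞} (ha : Measurable a) (hb : Measurable b) (hF : Measurable F)
    (hab : ∀ᵐ t ∂μ, a t * b t = 1) :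
    (∫⁻ t, F t ∂μ) ^ 4 ≤ (∫⁻ t, a t ^ 2 ∂μ) ^ 3 * ∫⁻ t, b t ^ 6 * F t ^ 4 ∂μ := by
  have h1 : (∫⁻ t, F t ∂μ) ^ 2 ≤ (∫⁻ t, a t ^ 2 ∂μ) * ∫⁻ t, b t ^ 2 * F t ^ 2 ∂μ := by
    have : ∫⁻ t, F t ∂μ = ∫⁻ t, a t * (b t * F t) ∂μ := by
      refine lintegral_congr_ae ?_
      filter_upwards [hab] with t ht
      rw [← mul_assoc, ht, one_mul]
    rw [this]
    refine (ENNReal.lintegral_mul_sq_le μ ha.aemeasurable (hb.mul hF).aemeasurable).trans ?_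
    refine le_of_eq (congrArg _ (lintegral_congr fun t => ?_))
    exact mul_pow _ _ _
  have h2 : (∫⁻ t, b t ^ 2 * F t ^ 2 ∂μ) ^ 2 ≤
      (∫⁻ t, a t ^ 2 ∂μ) * ∫⁻ t, b t ^ 6 * F t ^ 4 ∂μ := by
    have : ∫⁻ t, b t ^ 2 * F t ^ 2 ∂μ = ∫⁻ t, a t * (b t ^ 3 * F t ^ 2) ∂μ := by
      refine lintegral_congr_ae ?_
      filter_upwards [hab] with t ht
      rw [show a t * (b t ^ 3 * F t ^ 2) = (a t * b t) * (b t ^ 2 * F t ^ 2) by ring, ht, one_mul]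
    rw [this]
    refine (ENNReal.lintegral_mul_sq_le μ ha.aemeasurable
      ((hb.pow_const 3).mul (hF.pow_const 2)).aemeasurable).trans (le_of_eq ?_)
    congr 1
    refine lintegral_congr fun t => ?_
    rw [Pi.mul_apply]
    ring
  calc (∫⁻ t, F t ∂μ) ^ 4 = ((∫⁻ t, F t ∂μ) ^ 2) ^ 2 := by ring
    _ ≤ ((∫⁻ t, a t ^ 2 ∂μ) * ∫⁻ t, b t ^ 2 * F t ^ 2 ∂μ) ^ 2 := by gcongr
    _ = (∫⁻ t, a t ^ 2 ∂μ) ^ 2 * (∫⁻ t, b t ^ 2 * F t ^ 2 ∂μ) ^ 2 := by ring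
    _ ≤ (∫⁻ t, a t ^ 2 ∂μ) ^ 2 * ((∫⁻ t, a t ^ 2 ∂μ) * ∫⁻ t, b t ^ 6 * F t ^ 4 ∂μ) := by gcongr
    _ = _ := by ring

/-- The integral of `h` over the ball `x + t B`, in the variable of `B`. -/
def dilatedIntegral (B : Set Space3) (h : Space3 → ℝ≥0∞) (t : ℝ) (x : Space3) : ℝ≥0∞ :=
  ∫⁻ z in B, h (x + t • z)

variable {B : Set Space3} {h : Space3 → ℝ≥0∞}

theorem measurable_dilatedIntegral (hh : Measurable h) :
    Measurable fun p : ℝ × Space3 => dilatedIntegral B h p.1 p.2 := by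
  unfold dilatedIntegral
  refine Measurable.lintegral_prod_right'
    (f := fun q : (ℝ × Space3) × Space3 => h (q.1.2 + q.1.1 • q.2)) ?_
  fun_prop

/-- Enlarging `B` to the whole space, the substitution `y = t z` costs `t⁻³` in dimension three. -/
theorem dilatedIntegral_le (hh : Measurable h) {t : ℝ} (ht : 0 < t) (x : Space3) :
    dilatedIntegral B h t x ≤ ENNReal.ofReal (t ^ 3)⁻¹ * ∫⁻ y, h y := by
  calc dilatedIntegral B h t x ≤ ∫⁻ z, h (x + t • z) := setLIntegral_le_lintegral _ _
    _ = ∫⁻ y, h (x + y) ∂(Measure.map (fun z : Space3 => t • z) volume) := by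
        rw [lintegral_map (f := fun y => h (x + y)) (by fun_prop) (by fun_prop)]
    _ = ENNReal.ofReal (t ^ 3)⁻¹ * ∫⁻ y, h y := by
        rw [Measure.map_addHaar_smul _ ht.ne', lintegral_smul_measure, lintegral_add_left_eq_self,
          finrank_euclideanSpace_fin, abs_of_pos (by positivity), smul_eq_mul]

theorem lintegral_dilatedIntegral (hh : Measurable h) (t : ℝ) :
    ∫⁻ x, dilatedIntegral B h t x = volume B * ∫⁻ y, h y := by
  unfold dilatedIntegral
  rw [lintegral_lintegral_swap]
  · simp only [lintegral_add_right_eq_self h, lintegral_const, Measure.restrict_apply_univ]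
    rw [mul_comm]
  · exact Measurable.aemeasurable (by unfold Function.uncurry; fun_prop)

theorem dilatedIntegral_sq_le (hh : Measurable h) (t : ℝ) (x : Space3) :
    dilatedIntegral B h t x ^ 2 ≤ volume B * dilatedIntegral B (fun y => h y ^ 2) t x := by
  have := ENNReal.lintegral_mul_sq_le (volume.restrict B) (f := fun _ => 1)
    (g := fun z => h (x + t • z)) aemeasurable_const (Measurable.aemeasurable (by fun_prop))
  simpa [dilatedIntegral] using this

theorem dilatedIntegral_pow_four_le (hh : Measurable h) (t : ℝ) (x : Space3) :
    dilatedIntegral B h t x ^ 4 ≤ volume B ^ 3 * dilatedIntegral B (fun y => h y ^ 4) t x := by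
  calc dilatedIntegral B h t x ^ 4 = (dilatedIntegral B h t x ^ 2) ^ 2 := by ring
    _ ≤ (volume B * dilatedIntegral B (fun y => h y ^ 2) t x) ^ 2 := by
        gcongr
        exact dilatedIntegral_sq_le hh t x
    _ = volume B ^ 2 * dilatedIntegral B (fun y => h y ^ 2) t x ^ 2 := by ring
    _ ≤ volume B ^ 2 * (volume B * dilatedIntegral B (fun y => (h y ^ 2) ^ 2) t x) := by
        gcongr
        exact dilatedIntegral_sq_le (hh.pow_const 2) t x
    _ = _ := by
        simp only [← pow_mul]
        ring

theorem dilatedIntegral_pow_four_le_of_pos (hh : Measurable h) {t : ℝ} (ht : 0 < t)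
    (x : Space3) :
    dilatedIntegral B h t x ^ 4 ≤
      volume B ^ 3 * ENNReal.ofReal (t ^ 3)⁻¹ * ∫⁻ y, h y ^ 4 := by
  refine (dilatedIntegral_pow_four_le hh t x).trans ?_
  rw [mul_assoc]
  gcongr
  exact dilatedIntegral_le (hh.pow_const 4) ht x

/-- After Cauchy–Schwarz the fourth power is at most a square of a dilated integral of `h²`. One
factor is bounded pointwise at cost `t⁻³`; the other is integrated over `x`, where translation
invariance leaves no power of `t`. So only a single `t⁻³` appears. -/
theorem lintegral_dilatedIntegral_pow_four_le (hh : Measurable h) {t : ℝ} (ht : 0 < t) :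
    ∫⁻ x, dilatedIntegral B h t x ^ 4 ≤
      volume B ^ 3 * ENNReal.ofReal (t ^ 3)⁻¹ * (∫⁻ y, h y ^ 2) ^ 2 := by
  set c := volume B ^ 2 * (ENNReal.ofReal (t ^ 3)⁻¹ * ∫⁻ y, h y ^ 2) with hc
  have h1 : ∀ x, dilatedIntegral B h t x ^ 4 ≤
      c * dilatedIntegral B (fun y => h y ^ 2) t x := by
    intro x
    calc dilatedIntegral B h t x ^ 4 = (dilatedIntegral B h t x ^ 2) ^ 2 := by ring
      _ ≤ (volume B * dilatedIntegral B (fun y => h y ^ 2) t x) ^ 2 := by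
          gcongr
          exact dilatedIntegral_sq_le hh t x
      _ = volume B ^ 2 * dilatedIntegral B (fun y => h y ^ 2) t x *
            dilatedIntegral B (fun y => h y ^ 2) t x := by ring
      _ ≤ c * dilatedIntegral B (fun y => h y ^ 2) t x := by
          rw [hc]
          gcongr
          exact dilatedIntegral_le (hh.pow_const 2) ht x
  have hm : Measurable fun x => dilatedIntegral B (fun y => h y ^ 2) t x :=
    (measurable_dilatedIntegral (B := B) (hh.pow_const 2)).comp measurable_prodMk_left
  calc ∫⁻ x, dilatedIntegral B h t x ^ 4
      ≤ ∫⁻ x, c * dilatedIntegral B (fun y => h y ^ 2) t x := lintegral_mono h1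
    _ = c * (volume B * ∫⁻ y, h y ^ 2) := by
        rw [lintegral_const_mul _ hm, lintegral_dilatedIntegral (hh.pow_const 2)]
    _ = _ := by rw [hc]; ring

/-- The integral of `h` over the cones with vertex `x` over `x + B`. -/
def coneIntegral (B : Set Space3) (h : Space3 → ℝ≥0∞) (x : Space3) : ℝ≥0∞ :=
  ∫⁻ t in Ioo (0 : ℝ) 1, dilatedIntegral B h t x

theorem lintegral_ofReal_rpow_lt_top {s : ℝ} (hs : -1 < s) :
    ∫⁻ t in Ioo (0 : ℝ) 1, ENNReal.ofReal (t ^ s) < ⊤ := by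
  have h1 : IntegrableOn (fun t : ℝ => t ^ s) (Ioo 0 1) :=
    ((intervalIntegral.intervalIntegrable_rpow' hs (a := 0) (b := 1)).1).mono_set
      Ioo_subset_Ioc_self
  exact h1.lintegral_lt_top

/-- There is a weight that makes the singularity `t⁻³` integrable in `L⁴`-estimates. -/
theorem exists_weight :
    ∃ a b : ℝ → ℝ≥0∞, Measurable a ∧ Measurable b ∧
      (∀ᵐ t ∂volume.restrict (Ioo (0 : ℝ) 1), a t * b t = 1) ∧
      ∫⁻ t in Ioo (0 : ℝ) 1, a t ^ 2 < ⊤ ∧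
      ∫⁻ t in Ioo (0 : ℝ) 1, b t ^ 6 * ENNReal.ofReal (t ^ 3)⁻¹ < ⊤ := by
  -- With `b = t^α` and `a = t^(-α)`, integrability of `a²` requires `α < 1/2` and that of `b⁶ t⁻³`
  -- requires `α > 1/3`. The choice `α = 2/5` yields the exponents `-4/5` and `-3/5`.
  refine ⟨fun t => ENNReal.ofReal (t ^ (-2 / 5 : ℝ)), fun t => ENNReal.ofReal (t ^ (2 / 5 : ℝ)),
    by fun_prop, by fun_prop, ?_, ?_, ?_⟩
  · filter_upwards [ae_restrict_mem measurableSet_Ioo] with t ht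
    rw [← ENNReal.ofReal_mul (Real.rpow_nonneg ht.1.le _), ← Real.rpow_add ht.1]
    norm_num
  · refine lt_of_eq_of_lt (setLIntegral_congr_fun measurableSet_Ioo fun t ht => ?_)
      (lintegral_ofReal_rpow_lt_top (s := -4 / 5) (by norm_num))
    simp only
    rw [← ENNReal.ofReal_pow (Real.rpow_nonneg ht.1.le _), ← Real.rpow_natCast,
      ← Real.rpow_mul ht.1.le]
    norm_num
  · refine lt_of_eq_of_lt (setLIntegral_congr_fun measurableSet_Ioo fun t ht => ?_)
      (lintegral_ofReal_rpow_lt_top (s := -3 / 5) (by norm_num))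
    simp only
    rw [← ENNReal.ofReal_pow (Real.rpow_nonneg ht.1.le _), ← Real.rpow_natCast (t ^ (2 / 5 : ℝ)),
      ← Real.rpow_mul ht.1.le, ← ENNReal.ofReal_mul (Real.rpow_nonneg ht.1.le _),
      ← Real.rpow_natCast t 3, ← Real.rpow_neg ht.1.le, ← Real.rpow_add ht.1]
    norm_num

/-- These are the bounds `L⁴ → L^∞` and `L² → L⁴` for the cone operator. The weight turns the fourth
power of the integral over `t` into an integral of fourth powers; each slice costs `t⁻³`, which the
factor `b⁶` makes integrable. -/
theorem exists_coneIntegral_pow_four_le (hB : volume B ≠ ⊤) :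
    ∃ C : ℝ≥0∞, C ≠ ⊤ ∧ ∀ h : Space3 → ℝ≥0∞, Measurable h →
      (∀ x, coneIntegral B h x ^ 4 ≤ C * ∫⁻ y, h y ^ 4) ∧
      ∫⁻ x, coneIntegral B h x ^ 4 ≤ C * (∫⁻ y, h y ^ 2) ^ 2 := by
  obtain ⟨a, b, ha, hb, hab, hS, hJ⟩ := exists_weight
  set S := ∫⁻ t in Ioo (0 : ℝ) 1, a t ^ 2
  set J := ∫⁻ t in Ioo (0 : ℝ) 1, b t ^ 6 * ENNReal.ofReal (t ^ 3)⁻¹ with hJdef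
  have hJm : Measurable fun t : ℝ => b t ^ 6 * ENNReal.ofReal (t ^ 3)⁻¹ := by fun_prop
  refine ⟨S ^ 3 * (volume B ^ 3 * J), by finiteness, fun h hh => ?_⟩
  have hm := measurable_dilatedIntegral (B := B) hh
  have hmt : ∀ x, Measurable fun t => dilatedIntegral B h t x := fun x =>
    hm.comp measurable_prodMk_right
  have key : ∀ x, coneIntegral B h x ^ 4 ≤
      S ^ 3 * ∫⁻ t in Ioo (0 : ℝ) 1, b t ^ 6 * dilatedIntegral B h t x ^ 4 := fun x =>
    ENNReal.lintegral_pow_four_le _ ha hb (hmt x) hab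
  constructor
  · intro x
    refine (key x).trans ?_
    calc S ^ 3 * ∫⁻ t in Ioo (0 : ℝ) 1, b t ^ 6 * dilatedIntegral B h t x ^ 4
        ≤ S ^ 3 * ∫⁻ t in Ioo (0 : ℝ) 1, (b t ^ 6 * ENNReal.ofReal (t ^ 3)⁻¹) *
            (volume B ^ 3 * ∫⁻ y, h y ^ 4) := by
          gcongr S ^ 3 * ?_
          refine setLIntegral_mono (hJm.mul_const _) fun t ht => ?_
          calc b t ^ 6 * dilatedIntegral B h t x ^ 4
              ≤ b t ^ 6 * (volume B ^ 3 * ENNReal.ofReal (t ^ 3)⁻¹ * ∫⁻ y, h y ^ 4) := by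
                gcongr
                exact dilatedIntegral_pow_four_le_of_pos hh ht.1 x
            _ = _ := by ring
      _ = _ := by
          rw [lintegral_mul_const _ hJm, ← hJdef]
          ring
  · have hm2 : Measurable fun p : ℝ × Space3 => b p.1 ^ 6 * dilatedIntegral B h p.1 p.2 ^ 4 :=
      ((hb.comp measurable_fst).pow_const 6).mul (hm.pow_const 4)
    calc ∫⁻ x, coneIntegral B h x ^ 4
        ≤ ∫⁻ x, S ^ 3 * ∫⁻ t in Ioo (0 : ℝ) 1, b t ^ 6 * dilatedIntegral B h t x ^ 4 :=
          lintegral_mono key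
      _ = S ^ 3 * ∫⁻ t in Ioo (0 : ℝ) 1, ∫⁻ x, b t ^ 6 * dilatedIntegral B h t x ^ 4 := by
          rw [lintegral_const_mul' _ _ (by finiteness), lintegral_lintegral_swap]
          exact (hm2.comp measurable_swap).aemeasurable
      _ ≤ S ^ 3 * ∫⁻ t in Ioo (0 : ℝ) 1, (b t ^ 6 * ENNReal.ofReal (t ^ 3)⁻¹) *
            (volume B ^ 3 * (∫⁻ y, h y ^ 2) ^ 2) := by
          gcongr S ^ 3 * ?_
          refine setLIntegral_mono (hJm.mul_const _) fun t ht => ?_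
          have hmx : Measurable fun x => dilatedIntegral B h t x := hm.comp measurable_prodMk_left
          rw [lintegral_const_mul _ (hmx.pow_const 4)]
          calc b t ^ 6 * ∫⁻ x, dilatedIntegral B h t x ^ 4
              ≤ b t ^ 6 * (volume B ^ 3 * ENNReal.ofReal (t ^ 3)⁻¹ * (∫⁻ y, h y ^ 2) ^ 2) := by
                gcongr
                exact lintegral_dilatedIntegral_pow_four_le hh ht.1
            _ = _ := by ring
      _ = _ := by
          rw [lintegral_mul_const _ hJm, ← hJdef]
          ring

end ConeIntegrals

/-! ### Sobolev bounds, from cones to the whole domain. -/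

section SobolevBounds

open scoped ENNReal

theorem ENNReal.add_pow_four_le (a b : ℝ≥0∞) : (a + b) ^ 4 ≤ 16 * (a ^ 4 + b ^ 4) := by
  rcases le_total a b with h | h
  · calc (a + b) ^ 4 ≤ (b + b) ^ 4 := by gcongr
      _ = 16 * b ^ 4 := by ring
      _ ≤ _ := by gcongr; exact le_add_self
  · calc (a + b) ^ 4 ≤ (a + a) ^ 4 := by gcongr
      _ = 16 * a ^ 4 := by ring
      _ ≤ _ := by gcongr; exact le_self_add

theorem ENNReal.sum_fin_three_pow_le (a : Fin 3 → ℝ≥0∞) (n : ℕ) :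
    (∑ i, a i) ^ n ≤ 3 ^ n * ∑ i, a i ^ n := by
  obtain ⟨m, -, hm⟩ := Finset.exists_max_image Finset.univ a Finset.univ_nonempty
  calc (∑ i, a i) ^ n ≤ (∑ _i : Fin 3, a m) ^ n := by
        gcongr with i hi
        exact hm i hi
    _ = 3 ^ n * a m ^ n := by simp [mul_pow]
    _ ≤ _ := by
        gcongr
        exact Finset.single_le_sum (f := fun i => a i ^ n) (fun _ _ => zero_le)
          (Finset.mem_univ m)

variable {Ω U : Set Space3} {F : Type*} [NormedAddCommGroup F] [NormedSpace ℝ F]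

/-- `f` is a function on the whole space that has weak partial derivatives `g i` in `Ω`, all of
these being integrable. -/
structure IsWeakGradient (Ω : Set Space3) (f : Space3 → F) (g : Fin 3 → Space3 → F) : Prop where
  measurable : StronglyMeasurable f
  measurable_deriv : ∀ i, StronglyMeasurable (g i)
  integrable : Integrable f
  integrable_deriv : ∀ i, Integrable (g i)
  isWeakPartial : ∀ i, IsWeakPartial Ω i f (g i)

variable {f : Space3 → F} {g : Fin 3 → Space3 → F}

theorem IsWeakGradient.measurable_sum (h : IsWeakGradient Ω f g) :
    Measurable fun x => ∑ i, ‖g i x‖ₑ :=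
  Finset.measurable_fun_sum _ fun i _ => (h.measurable_deriv i).enorm

/-- Pointwise bound of a weakly differentiable function by integrals over a cone. -/
theorem IsWeakGradient.ae_enorm_le [CompleteSpace F] (h : IsWeakGradient Ω f g) (hU : IsOpen U) {z₀ : Space3}
    {ρ : ℝ} (hcone : HasCones Ω U z₀ ρ) :
    ∀ᵐ x ∂volume.restrict U, volume (Metric.ball z₀ ρ) * ‖f x‖ₑ ≤
      dilatedIntegral (Metric.ball z₀ ρ) (fun y => ‖f y‖ₑ) 1 x +
      ENNReal.ofReal (‖z₀‖ + ρ) *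
        coneIntegral (Metric.ball z₀ ρ) (fun y => ∑ i, ‖g i y‖ₑ) x := by
  set B := Metric.ball z₀ ρ with hB
  set D := ENNReal.ofReal (‖z₀‖ + ρ) with hD
  have hfm : Measurable fun y => ‖f y‖ₑ := h.measurable.enorm
  have hΓ := h.measurable_sum
  have hΓ3 : Measurable fun p : (Space3 × Space3) × ℝ => ∑ i, ‖g i (p.1.2 + p.2 • p.1.1)‖ₑ :=
    hΓ.comp (by fun_prop : Measurable fun p : (Space3 × Space3) × ℝ => p.1.2 + p.2 • p.1.1)
  have hΓ2 : Measurable fun p : Space3 × Space3 =>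
      ∫⁻ t in Ioo (0 : ℝ) 1, ∑ i, ‖g i (p.2 + t • p.1)‖ₑ :=
    hΓ3.lintegral_prod_right'
  have key : ∀ᵐ z ∂volume.restrict B, ∀ᵐ x ∂volume.restrict U, ‖f x‖ₑ ≤ ‖f (x + z)‖ₑ +
      D * ∫⁻ t in Ioo (0 : ℝ) 1, ∑ i, ‖g i (x + t • z)‖ₑ := by
    filter_upwards [ae_restrict_mem Metric.isOpen_ball.measurableSet] with z hz
    have hzD : ∀ i, ‖z i‖ₑ ≤ D := fun i => by
      rw [← ofReal_norm]
      refine ENNReal.ofReal_le_ofReal ((PiLp.norm_apply_le z i).trans ?_)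
      have : ‖z - z₀‖ < ρ := by rwa [← dist_eq_norm]
      have := norm_le_norm_add_norm_sub' z z₀
      linarith
    rw [ae_restrict_iff' hU.measurableSet]
    filter_upwards [ae_sub_eq_integral_of_isWeakPartial hU (fun x hx t ht => hcone x hx z hz t ht)
      h.integrable h.integrable_deriv h.isWeakPartial] with x hx hxU
    have h1 : f x = f (x + z) - ∫ t in (0 : ℝ)..1, ∑ i, z i • g i (x + t • z) := by
      rw [← hx hxU]
      abel
    calc ‖f x‖ₑ ≤ ‖f (x + z)‖ₑ + ‖∫ t in (0 : ℝ)..1, ∑ i, z i • g i (x + t • z)‖ₑ := by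
          conv_lhs => rw [h1]
          exact enorm_sub_le
      _ ≤ _ := by
          gcongr
          rw [intervalIntegral.integral_of_le zero_le_one]
          refine (enorm_integral_le_lintegral_enorm _).trans ?_
          have hΓt : Measurable fun t : ℝ => ∑ i, ‖g i (x + t • z)‖ₑ :=
            hΓ.comp (by fun_prop : Measurable fun t : ℝ => x + t • z)
          rw [← setLIntegral_congr Ioo_ae_eq_Ioc, ← lintegral_const_mul _ hΓt]
          refine lintegral_mono fun t => ?_
          refine (enorm_sum_le _ _).trans ?_
          rw [Finset.mul_sum]
          refine Finset.sum_le_sum fun i _ => ?_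
          rw [enorm_smul]
          gcongr
          exact hzD i
  -- The segment estimate holds, for each `z`, for almost every `x`. Integrating in `z` at fixed `x`
  -- requires the opposite order of quantifiers, which Fubini allows for a measurable set of pairs.
  have hset : MeasurableSet {p : Space3 × Space3 | ‖f p.2‖ₑ ≤ ‖f (p.2 + p.1)‖ₑ +
      D * ∫⁻ t in Ioo (0 : ℝ) 1, ∑ i, ‖g i (p.2 + t • p.1)‖ₑ} :=
    measurableSet_le (hfm.comp measurable_snd)
      ((hfm.comp (measurable_snd.add measurable_fst)).add (hΓ2.const_mul D))
  rw [Measure.ae_ae_comm (p := fun z x => ‖f x‖ₑ ≤ ‖f (x + z)‖ₑ +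
    D * ∫⁻ t in Ioo (0 : ℝ) 1, ∑ i, ‖g i (x + t • z)‖ₑ) hset] at key
  filter_upwards [key] with x hx
  have hΓx : Measurable fun p : Space3 × ℝ => ∑ i, ‖g i (x + p.2 • p.1)‖ₑ :=
    hΓ.comp (by fun_prop : Measurable fun p : Space3 × ℝ => x + p.2 • p.1)
  calc volume B * ‖f x‖ₑ = ∫⁻ _z in B, ‖f x‖ₑ := by simp [mul_comm]
    _ ≤ ∫⁻ z in B, (‖f (x + z)‖ₑ + D * ∫⁻ t in Ioo (0 : ℝ) 1, ∑ i, ‖g i (x + t • z)‖ₑ) :=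
        lintegral_mono_ae hx
    _ = _ := by
        have hfx : Measurable fun z => ‖f (x + z)‖ₑ := hfm.comp (measurable_const_add x)
        rw [lintegral_add_left hfx,
          lintegral_const_mul _ hΓx.lintegral_prod_right']
        congr 1
        · simp [dilatedIntegral]
        · rw [lintegral_lintegral_swap]
          · rfl
          · exact hΓx.aemeasurable

variable (F) in
/-- The Sobolev bounds `W^{1,2} ⊆ L⁴` and `W^{1,4} ⊆ L^∞`, on a part `S` of `Ω`. -/
def SobolevBounds (Ω S : Set Space3) : Prop :=
  ∃ C : ℝ≥0∞, C ≠ ⊤ ∧ ∀ (f : Space3 → F) (g : Fin 3 → Space3 → F), IsWeakGradient Ω f g →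
    (∫⁻ x in S, ‖f x‖ₑ ^ 4 ≤ C * ((∫⁻ y, ‖f y‖ₑ ^ 2) ^ 2 + (∫⁻ y, (∑ i, ‖g i y‖ₑ) ^ 2) ^ 2)) ∧
    ∀ᵐ x ∂volume.restrict S,
      ‖f x‖ₑ ^ 4 ≤ C * ((∫⁻ y, ‖f y‖ₑ ^ 4) + ∫⁻ y, (∑ i, ‖g i y‖ₑ) ^ 4)

/-- The pointwise cone bound is divided by the volume of the ball and raised to the fourth power.
The term with `f` is a dilated integral at `t = 1`, where the factor `t⁻³` is harmless; the gradient
term is a cone integral. -/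
theorem sobolevBounds_of_hasCones [CompleteSpace F] (hU : IsOpen U) {z₀ : Space3} {ρ : ℝ} (hρ : 0 < ρ)
    (hcone : HasCones Ω U z₀ ρ) : SobolevBounds F Ω U := by
  set B := Metric.ball z₀ ρ with hB
  set D := ENNReal.ofReal (‖z₀‖ + ρ) with hD
  have hV : volume B ≠ ⊤ := measure_ball_lt_top.ne
  have hV0 : volume B ≠ 0 := (Metric.measure_ball_pos _ _ hρ).ne'
  obtain ⟨C, hC, hCbound⟩ := exists_coneIntegral_pow_four_le hV
  set V := volume B
  have hV4 : V ^ 4 ≠ 0 := pow_ne_zero _ hV0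
  have hV4' : V ^ 4 ≠ ⊤ := by finiteness
  set K := V ^ 3 + D ^ 4 * C with hK
  have hDtop : D ≠ ⊤ := ENNReal.ofReal_ne_top
  refine ⟨(V ^ 4)⁻¹ * (16 * K), by finiteness, fun f g h => ?_⟩
  obtain ⟨hC1, hC2⟩ := hCbound _ h.measurable_sum
  have hfm : Measurable fun y => ‖f y‖ₑ := h.measurable.enorm
  have hpt : ∀ᵐ x ∂volume.restrict U, ‖f x‖ₑ ^ 4 ≤ (V ^ 4)⁻¹ * (16 *
      (dilatedIntegral B (fun y => ‖f y‖ₑ) 1 x ^ 4 +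
        D ^ 4 * coneIntegral B (fun y => ∑ i, ‖g i y‖ₑ) x ^ 4)) := by
    filter_upwards [h.ae_enorm_le hU hcone] with x hx
    rw [← ENNReal.mul_le_iff_le_inv hV4 hV4', ← mul_pow]
    calc (V * ‖f x‖ₑ) ^ 4 ≤ _ := pow_le_pow_left' hx 4
      _ ≤ _ := ENNReal.add_pow_four_le _ _
      _ = _ := by rw [mul_pow]
  have hone : ENNReal.ofReal ((1 : ℝ) ^ 3)⁻¹ = 1 := by simp
  constructor
  · have hm1 : Measurable fun x => dilatedIntegral B (fun y => ‖f y‖ₑ) 1 x ^ 4 :=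
      ((measurable_dilatedIntegral hfm).comp measurable_prodMk_left).pow_const 4
    calc ∫⁻ x in U, ‖f x‖ₑ ^ 4
        ≤ ∫⁻ x in U, (V ^ 4)⁻¹ * (16 * (dilatedIntegral B (fun y => ‖f y‖ₑ) 1 x ^ 4 +
            D ^ 4 * coneIntegral B (fun y => ∑ i, ‖g i y‖ₑ) x ^ 4)) := lintegral_mono_ae hpt
      _ ≤ ∫⁻ x, (V ^ 4)⁻¹ * (16 * (dilatedIntegral B (fun y => ‖f y‖ₑ) 1 x ^ 4 +
            D ^ 4 * coneIntegral B (fun y => ∑ i, ‖g i y‖ₑ) x ^ 4)) :=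
          setLIntegral_le_lintegral _ _
      _ = (V ^ 4)⁻¹ * (16 * ((∫⁻ x, dilatedIntegral B (fun y => ‖f y‖ₑ) 1 x ^ 4) +
            D ^ 4 * ∫⁻ x, coneIntegral B (fun y => ∑ i, ‖g i y‖ₑ) x ^ 4)) := by
          rw [lintegral_const_mul' _ _ (by finiteness), lintegral_const_mul' _ _ (by finiteness),
            lintegral_add_left hm1, lintegral_const_mul' _ _ (by finiteness)]
      _ ≤ (V ^ 4)⁻¹ * (16 * (V ^ 3 * (∫⁻ y, ‖f y‖ₑ ^ 2) ^ 2 +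
            D ^ 4 * (C * (∫⁻ y, (∑ i, ‖g i y‖ₑ) ^ 2) ^ 2))) := by
          gcongr
          simpa [hone] using lintegral_dilatedIntegral_pow_four_le (B := B) hfm one_pos
      _ ≤ _ := by
          rw [mul_assoc, mul_assoc, mul_add K, ← mul_assoc (D ^ 4)]
          gcongr
          · exact le_self_add
          · exact le_add_self
  · filter_upwards [hpt] with x hx
    refine hx.trans ?_
    calc _ ≤ (V ^ 4)⁻¹ * (16 * (V ^ 3 * (∫⁻ y, ‖f y‖ₑ ^ 4) +
            D ^ 4 * (C * ∫⁻ y, (∑ i, ‖g i y‖ₑ) ^ 4))) := by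
          gcongr
          · simpa [hone] using dilatedIntegral_pow_four_le_of_pos (B := B) hfm one_pos x
          · exact hC1 x
      _ ≤ _ := by
          rw [mul_assoc, mul_assoc, mul_add K, ← mul_assoc (D ^ 4)]
          gcongr
          · exact le_self_add
          · exact le_add_self

theorem SobolevBounds.mono {S T : Set Space3} (hST : S ⊆ T) (h : SobolevBounds F Ω T) :
    SobolevBounds F Ω S := by
  obtain ⟨C, hC, hb⟩ := h
  refine ⟨C, hC, fun f g hfg => ⟨(lintegral_mono_set hST).trans (hb f g hfg).1, ?_⟩⟩
  exact ae_mono (Measure.restrict_mono hST le_rfl) (hb f g hfg).2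

theorem SobolevBounds.union {S T : Set Space3} (hS : SobolevBounds F Ω S)
    (hT : SobolevBounds F Ω T) : SobolevBounds F Ω (S ∪ T) := by
  obtain ⟨C, hC, hb⟩ := hS
  obtain ⟨C', hC', hb'⟩ := hT
  refine ⟨C + C', by finiteness, fun f g hfg => ⟨?_, ?_⟩⟩
  · refine (lintegral_union_le _ S T).trans ?_
    rw [add_mul]
    exact add_le_add (hb f g hfg).1 (hb' f g hfg).1
  · rw [ae_restrict_union_iff]
    constructor
    · filter_upwards [(hb f g hfg).2] with x hx
      exact hx.trans (by gcongr; exact le_self_add)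
    · filter_upwards [(hb' f g hfg).2] with x hx
      exact hx.trans (by gcongr; exact le_add_self)

/-- The bounds pass to subsets and finite unions and hold near each point of the compact closure of
`Ω`, so compactness gives them on `Ω`. -/
theorem IsBoundedC21Domain.sobolevBounds [CompleteSpace F] (hΩ : IsBoundedC21Domain Ω) : SobolevBounds F Ω Ω := by
  have hcomp : IsCompact (closure Ω) := hΩ.isBounded.isCompact_closure
  suffices H : SobolevBounds F Ω (closure Ω ∩ Ω) from
    H.mono (subset_inter subset_closure subset_rfl)
  refine hcomp.induction_on (p := fun s => SobolevBounds F Ω (s ∩ Ω)) ?_ ?_ ?_ ?_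
  · exact ⟨0, by simp, fun f g _ => by simp⟩
  · exact fun s t hst h => h.mono (inter_subset_inter_left _ hst)
  · intro s t hs ht
    rw [union_inter_distrib_right]
    exact hs.union ht
  · intro x hx
    obtain ⟨N, hN, hNo, z₀, ρ, hρ, hcone⟩ := hΩ.exists_hasCones hx
    exact ⟨N, mem_nhdsWithin_of_mem_nhds hN,
      sobolevBounds_of_hasCones (hNo.inter hΩ.isOpen) hρ hcone⟩

end SobolevBounds

/-! ### The product rule for weak derivatives. -/

section ProductRule

variable {F₁ F₂ F₃ : Type*} [NormedAddCommGroup F₁] [NormedSpace ℝ F₁] [NormedAddCommGroup F₂]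
  [NormedSpace ℝ F₂] [NormedAddCommGroup F₃] [NormedSpace ℝ F₃]
  (B : F₁ →L[ℝ] F₂ →L[ℝ] F₃)

/-- The pairing of an `L²` function with the translates of another one is continuous. -/
theorem continuous_integral_bilin_translate [CompleteSpace F₃] {u : Space3 → F₁} {v : Space3 → F₂}
    (hu : MemLp u 2) (hv : MemLp v 2) : Continuous fun z => ∫ x, B (u x) (v (x - z)) := by
  have hmp : ∀ z : Space3, MeasurePreserving (fun x : Space3 => x - z) volume volume := fun z =>
    measurePreserving_sub_right volume z
  let T : Space3 → C(Space3, Space3) := fun z => ⟨fun x => x - z, by fun_prop⟩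
  have hT : Continuous T :=
    (ContinuousMap.mk (fun p : Space3 × Space3 => p.2 - p.1) (by fun_prop)).curry.continuous
  have hc : Continuous fun z => Lp.compMeasurePreserving (T z) (hmp z) (hv.toLp v) :=
    (continuous_const (y := hv.toLp v)).compMeasurePreservingLp hT hmp (by simp)
  have h2 := (B.lpPairing volume 2 2 (hu.toLp u)).continuous.comp hc
  refine h2.congr fun z => ?_
  simp only [Function.comp_apply]
  rw [ContinuousLinearMap.lpPairing_eq_integral]
  refine integral_congr_ae ?_
  filter_upwards [hu.coeFn_toLp, Lp.coeFn_compMeasurePreserving (hv.toLp v) (hmp z),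
    (hmp z).quasiMeasurePreserving.ae hv.coeFn_toLp] with x h1 h2 h3
  rw [h1]
  congr 1
  exact h2.trans h3

/-- The double integral `∫∫ η(x - y) B(u(x), v(y)) dy dx`. -/
def convPairing (η : Space3 → ℝ) (u : Space3 → F₁) (v : Space3 → F₂) : F₃ :=
  ∫ x, ∫ y, η (x - y) • B (u x) (v y)

theorem integrable_bilin_prod {u : Space3 → F₁} {v : Space3 → F₂} (hu : Integrable u)
    (hv : Integrable v) :
    Integrable (fun p : Space3 × Space3 => B (u p.1) (v p.2)) (volume.prod volume) := by
  refine Integrable.mono' ((hu.norm.mul_prod hv.norm).const_mul ‖B‖)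
    (B.aestronglyMeasurable_comp₂ hu.1.comp_fst hv.1.comp_snd) (.of_forall fun p => ?_)
  rw [← mul_assoc]
  exact B.le_opNorm₂ _ _

variable {η : Space3 → ℝ} {u : Space3 → F₁} {v : Space3 → F₂}

theorem integrable_convPairing (hη : Continuous η) (hc : HasCompactSupport η) (hu : Integrable u)
    (hv : Integrable v) :
    Integrable (fun p : Space3 × Space3 => η (p.1 - p.2) • B (u p.1) (v p.2))
      (volume.prod volume) := by
  obtain ⟨C, hC⟩ := hη.bounded_above_of_compact_support hc
  exact (integrable_bilin_prod B hu hv).bdd_smul C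
    (by fun_prop : Continuous fun p : Space3 × Space3 => η (p.1 - p.2)).aestronglyMeasurable
    (.of_forall fun p => hC _)

theorem convPairing_eq_swap (η : Space3 → ℝ) (u : Space3 → F₁) (v : Space3 → F₂)
    (h : Integrable (fun p : Space3 × Space3 => η (p.1 - p.2) • B (u p.1) (v p.2))
      (volume.prod volume)) :
    convPairing B η u v = ∫ y, ∫ x, η (x - y) • B (u x) (v y) :=
  integral_integral_swap h

/-- Fubini and the substitution `y = x - z`: mollifying the translation parameter produces the
smooth kernel `η(x - y)`, which can be differentiated in either variable. -/
theorem integral_smul_integral_bilin_translate (hη : Continuous η) (hc : HasCompactSupport η)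
    (hu : Integrable u) (hv : Integrable v) :
    ∫ z, η z • ∫ x, B (u x) (v (x - z)) = convPairing B η u v := by
  obtain ⟨C, hC⟩ := hη.bounded_above_of_compact_support hc
  have hint : Integrable (fun p : Space3 × Space3 => η p.1 • B (u p.2) (v (p.2 - p.1)))
      (volume.prod volume) := by
    have h1 := hu.convolution_integrand B hv.comp_neg
    simp only [neg_sub] at h1
    exact h1.bdd_smul C (hη.comp continuous_fst).aestronglyMeasurable (.of_forall fun p => hC _)
  simp only [← integral_smul]
  rw [integral_integral_swap (f := fun z x => η z • B (u x) (v (x - z))) hint, convPairing]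
  refine integral_congr_ae (.of_forall fun x => ?_)
  simp only
  rw [← integral_sub_left_eq_self (fun z => η z • B (u x) (v (x - z))) volume x]
  simp

variable {Ω : Set Space3} {i : Fin 3}

theorem partialDeriv_mul {φ ψ : Space3 → ℝ} (hφ : ContDiff ℝ ∞ φ) (hψ : ContDiff ℝ ∞ ψ)
    (x : Space3) :
    partialDeriv i (fun x => φ x * ψ x) x = partialDeriv i φ x * ψ x + φ x * partialDeriv i ψ x := by
  unfold partialDeriv
  rw [fderiv_fun_mul (hφ.differentiable (by simp) x) (hψ.differentiable (by simp) x)]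
  simp
  ring

theorem partialDeriv_comp_sub_const {ψ : Space3 → ℝ} (x y : Space3) :
    partialDeriv i (fun x => ψ (x - y)) x = partialDeriv i ψ (x - y) := by
  unfold partialDeriv
  simp only [sub_eq_add_neg, fderiv_comp_add_right]

theorem partialDeriv_comp_const_sub {ψ : Space3 → ℝ} (hψ : ContDiff ℝ ∞ ψ) (x y : Space3) :
    partialDeriv i (fun y => ψ (x - y)) y = -partialDeriv i ψ (x - y) := by
  unfold partialDeriv
  have h1 : HasFDerivAt (fun y : Space3 => x - y) (-(ContinuousLinearMap.id ℝ Space3)) y :=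
    (hasFDerivAt_id y).const_sub x
  have h2 := ((hψ.differentiable (by simp) (x - y)).hasFDerivAt).comp y h1
  rw [show (fun y => ψ (x - y)) = ψ ∘ fun y => x - y from rfl, h2.fderiv]
  simp

/-- Shifting a derivative in `convPairing` from the kernel to the functions. -/
theorem convPairing_product_rule [CompleteSpace F₃] [CompleteSpace F₁] [CompleteSpace F₂] {f f' : Space3 → F₁}
    {g g' : Space3 → F₂} (hf : Integrable f) (hf' : Integrable f') (hg : Integrable g)
    (hg' : Integrable g') (hff' : IsWeakPartial Ω i f f') (hgg' : IsWeakPartial Ω i g g')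
    {φ : Space3 → ℝ} (hφ : IsTestFunction Ω φ) (hη : ContDiff ℝ ∞ η) (hc : HasCompactSupport η)
    (hsupp : ∀ x ∈ tsupport φ, ∀ z ∈ tsupport η, x - z ∈ Ω) :
    convPairing B η (fun x => partialDeriv i φ x • f x) g +
      convPairing B η (fun x => φ x • f' x) g + convPairing B η (fun x => φ x • f x) g' = 0 := by
  have hη' : Continuous (partialDeriv i η) :=
    (hη.continuous_fderiv (by simp)).clm_apply continuous_const
  have hc' : HasCompactSupport (partialDeriv i η) :=
    hc.fderiv_apply ℝ (EuclideanSpace.single i 1)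
  have i1 := integrable_convPairing B hη.continuous hc (hφ.integrable_partialDeriv_smul i hf) hg
  have i2 := integrable_convPairing B hη.continuous hc (hφ.integrable_smul hf') hg
  have i3 := integrable_convPairing B hη' hc' (hφ.integrable_smul hf) hg
  -- the derivative of the kernel falls on `g`
  have hB : convPairing B (partialDeriv i η) (fun x => φ x • f x) g =
      convPairing B η (fun x => φ x • f x) g' := by
    unfold convPairing
    refine integral_congr_ae (.of_forall fun x => ?_)
    simp only
    by_cases hx : φ x = 0
    · simp [hx]
    have hxs : x ∈ tsupport φ := subset_tsupport _ hx
    have hts : tsupport (fun y => η (x - y)) ⊆ (fun z => x - z) '' tsupport η := by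
      refine closure_minimal ?_ (hc.image (by fun_prop)).isClosed
      intro y hy
      exact ⟨x - y, subset_tsupport _ hy, by simp⟩
    have htest : IsTestFunction Ω fun y => η (x - y) := by
      refine ⟨hη.comp (by fun_prop), ?_, ?_⟩
      · exact (hc.image (by fun_prop : Continuous fun z => x - z)).of_isClosed_subset
          (isClosed_tsupport _) hts
      · refine hts.trans ?_
        rintro _ ⟨z, hz, rfl⟩
        exact hsupp x hxs z hz
    have h1 := hgg' _ htest
    simp only [partialDeriv_comp_const_sub hη, neg_smul, integral_neg, neg_inj] at h1
    have h2 := congrArg (B (φ x • f x)) h1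
    rw [← ContinuousLinearMap.integral_comp_comm, ← ContinuousLinearMap.integral_comp_comm] at h2
    · simpa only [map_smul] using h2
    · exact htest.integrable_smul hg'
    · have := htest.integrable_partialDeriv_smul i hg
      simp only [partialDeriv_comp_const_sub hη, neg_smul] at this
      simpa using this.neg
  -- the derivative of the kernel falls on `φ • f`
  have hA : convPairing B η (fun x => partialDeriv i φ x • f x) g +
      convPairing B (partialDeriv i η) (fun x => φ x • f x) g +
        convPairing B η (fun x => φ x • f' x) g = 0 := by
    have k1 : Integrable fun y => ∫ x, η (x - y) • B (partialDeriv i φ x • f x) (g y) :=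
      i1.integral_prod_right
    have k2 : Integrable fun y => ∫ x, η (x - y) • B (φ x • f' x) (g y) :=
      i2.integral_prod_right
    have k3 : Integrable fun y => ∫ x, partialDeriv i η (x - y) • B (φ x • f x) (g y) :=
      i3.integral_prod_right
    have k13 : Integrable fun y => (∫ x, η (x - y) • B (partialDeriv i φ x • f x) (g y)) +
        ∫ x, partialDeriv i η (x - y) • B (φ x • f x) (g y) := k1.add k3
    rw [convPairing_eq_swap B η (fun x => partialDeriv i φ x • f x) g i1,
      convPairing_eq_swap B η (fun x => φ x • f' x) g i2,
      convPairing_eq_swap B (partialDeriv i η) (fun x => φ x • f x) g i3,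
      ← integral_add k1 k3, ← integral_add k13 k2]
    refine integral_eq_zero_of_ae ?_
    filter_upwards [i1.prod_left_ae, i2.prod_left_ae, i3.prod_left_ae] with y j1 j2 j3
    have hηy : ContDiff ℝ ∞ fun x => η (x - y) := hη.comp (by fun_prop)
    have htest : IsTestFunction Ω fun x => φ x * η (x - y) :=
      ⟨hφ.contDiff.mul hηy, hφ.hasCompactSupport.mul_right,
        (tsupport_mul_subset_left).trans hφ.tsupport_subset⟩
    have h1 := hff' _ htest
    have h2 := congrArg (B.flip (g y)) h1
    rw [map_neg, ← ContinuousLinearMap.integral_comp_comm _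
      (htest.integrable_partialDeriv_smul i hf), ← ContinuousLinearMap.integral_comp_comm _
      (htest.integrable_smul hf')] at h2
    simp only [Pi.zero_apply]
    rw [← integral_add j1 j3, ← eq_neg_iff_add_eq_zero]
    convert h2 using 1
    · refine integral_congr_ae (.of_forall fun x => ?_)
      simp only [partialDeriv_mul hφ.contDiff hηy, partialDeriv_comp_sub_const]
      simp only [ContinuousLinearMap.flip_apply, map_smul, smul_smul, add_smul, map_add,
        smul_apply]
      congr 2 <;> ring
    · congr 1
      refine integral_congr_ae (.of_forall fun x => ?_)
      simp only [ContinuousLinearMap.flip_apply, map_smul, smul_smul,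
        smul_apply]
      congr 1
      ring
  rw [hB] at hA
  rw [← hA]
  abel

/-- The product rule for weak derivatives. -/
theorem IsWeakPartial.bilin [CompleteSpace F₃] [CompleteSpace F₁] [CompleteSpace F₂] (hΩ : IsOpen Ω)
    {f f' : Space3 → F₁} {g g' : Space3 → F₂} (hf : Integrable f) (hf' : Integrable f')
    (hg : Integrable g) (hg' : Integrable g') (hf2 : MemLp f 2) (hf2' : MemLp f' 2)
    (hg2 : MemLp g 2) (hg2' : MemLp g' 2) (hff' : IsWeakPartial Ω i f f')
    (hgg' : IsWeakPartial Ω i g g') :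
    IsWeakPartial Ω i (fun x => B (f x) (g x)) (fun x => B (f' x) (g x) + B (f x) (g' x)) := by
  intro φ hφ
  obtain ⟨δ, hδ, hthick⟩ := hφ.hasCompactSupport.exists_thickening_subset_open hΩ
    hφ.tsupport_subset
  obtain ⟨C, hC⟩ := hφ.contDiff.continuous.bounded_above_of_compact_support hφ.hasCompactSupport
  obtain ⟨C', hC'⟩ := (hφ.continuous_partialDeriv i).bounded_above_of_compact_support
    (hφ.hasCompactSupport_partialDeriv i)
  have hφtop : MemLp φ ⊤ := memLp_top_of_bound hφ.contDiff.continuous.aestronglyMeasurable C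
    (.of_forall hC)
  have hφtop' : MemLp (partialDeriv i φ) ⊤ :=
    memLp_top_of_bound (hφ.continuous_partialDeriv i).aestronglyMeasurable C' (.of_forall hC')
  have m1 : MemLp (fun x => partialDeriv i φ x • f x) 2 := hf2.smul hφtop'
  have m2 : MemLp (fun x => φ x • f' x) 2 := hf2'.smul hφtop
  have m3 : MemLp (fun x => φ x • f x) 2 := hf2.smul hφtop
  have c1 := continuous_integral_bilin_translate B m1 hg2
  have c2 := continuous_integral_bilin_translate B m2 hg2
  have c3 := continuous_integral_bilin_translate B m3 hg2'
  -- The product rule tested with `φ`, with `g` and `g'` translated by `z`. The claim is `c 0 = 0`.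
  set c : Space3 → F₃ := fun z => (∫ x, B (partialDeriv i φ x • f x) (g (x - z))) +
    (∫ x, B (φ x • f' x) (g (x - z))) + ∫ x, B (φ x • f x) (g' (x - z)) with hcdef
  have hcont : Continuous c := (c1.add c2).add c3
  have hae : ∀ᵐ z, z ∈ Metric.ball (0 : Space3) δ → c z = 0 := by
    refine Metric.isOpen_ball.ae_eq_zero_of_integral_contDiff_smul_eq_zero
      (hcont.locallyIntegrable.locallyIntegrableOn _) fun η hη hηc hηs => ?_
    have hint : ∀ d : Space3 → F₃, Continuous d → Integrable fun z => η z • d z := fun d hd =>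
      (hη.continuous.smul hd).integrable_of_hasCompactSupport hηc.smul_right
    simp only [hcdef, smul_add]
    have h12 : Integrable fun z => η z • (∫ x, B (partialDeriv i φ x • f x) (g (x - z))) +
        η z • ∫ x, B (φ x • f' x) (g (x - z)) := (hint _ c1).add (hint _ c2)
    rw [integral_add h12 (hint _ c3),
      integral_add (hint _ c1) (hint _ c2),
      integral_smul_integral_bilin_translate B hη.continuous hηc
        (hφ.integrable_partialDeriv_smul i hf) hg,
      integral_smul_integral_bilin_translate B hη.continuous hηc (hφ.integrable_smul hf') hg,
      integral_smul_integral_bilin_translate B hη.continuous hηc (hφ.integrable_smul hf) hg']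
    refine convPairing_product_rule B hf hf' hg hg' hff' hgg' hφ hη hηc fun x hx z hz => ?_
    refine hthick (Metric.mem_thickening_iff.2 ⟨x, hx, ?_⟩)
    have := hηs hz
    rw [mem_ball_zero_iff] at this
    rwa [dist_eq_norm, sub_sub_cancel_left, norm_neg]
  -- Almost everywhere vanishing near `0` says nothing about the point `0` by itself; continuity of
  -- translation in `L²` supplies the value there.
  have hc0 : c 0 = 0 := by
    have h1 : c =ᵐ[volume.restrict (Metric.ball (0 : Space3) δ)] fun _ => (0 : F₃) :=
      (ae_restrict_iff' Metric.isOpen_ball.measurableSet).2 hae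
    exact Measure.eqOn_open_of_ae_eq h1 Metric.isOpen_ball hcont.continuousOn continuousOn_const
      (Metric.mem_ball_self hδ)
  simp only [hcdef, sub_zero] at hc0
  have j2 : Integrable fun x => B (φ x • f' x) (g x) :=
    memLp_one_iff_integrable.1 (B.memLp_of_bilin 1 m2 hg2)
  have j3 : Integrable fun x => B (φ x • f x) (g' x) :=
    memLp_one_iff_integrable.1 (B.memLp_of_bilin 1 m3 hg2')
  rw [add_assoc, ← integral_add j2 j3] at hc0
  simpa [eq_neg_iff_add_eq_zero, smul_add] using hc0

end ProductRule

/-! ### Sobolev embeddings for `H¹` and `H²`. -/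

section SobolevEmbedding

open scoped ENNReal NNReal

variable {Ω : Set Space3} {F : Type*} [NormedAddCommGroup F]

theorem IsBoundedC21Domain.isFiniteMeasure (hΩ : IsBoundedC21Domain Ω) :
    IsFiniteMeasure (volume.restrict Ω) :=
  ⟨by simpa using hΩ.isBounded.measure_lt_top⟩

theorem memLp_indicator_L2 (hΩ : IsOpen Ω) (u : L2 Ω F) : MemLp (Ω.indicator u) 2 :=
  (memLp_indicator_iff_restrict hΩ.measurableSet).2 (Lp.memLp u)

theorem IsBoundedC21Domain.integrable_L2 (hΩ : IsBoundedC21Domain Ω) (u : L2 Ω F) :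
    Integrable u (volume.restrict Ω) := by
  have := hΩ.isFiniteMeasure
  exact (Lp.memLp u).integrable one_le_two

theorem IsBoundedC21Domain.integrable_indicator_L2 (hΩ : IsBoundedC21Domain Ω) (u : L2 Ω F) :
    Integrable (Ω.indicator u) :=
  (integrable_indicator_iff hΩ.isOpen.measurableSet).2 (hΩ.integrable_L2 u)

theorem lintegral_indicator_enorm_pow (hΩ : IsOpen Ω) (u : L2 Ω F) {n : ℕ} (hn : n ≠ 0) :
    ∫⁻ x, ‖Ω.indicator u x‖ₑ ^ n = ∫⁻ x in Ω, ‖u x‖ₑ ^ n := by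
  rw [← lintegral_indicator hΩ.measurableSet]
  refine lintegral_congr fun x => ?_
  by_cases hx : x ∈ Ω <;> simp [hx, hn]

theorem eLpNorm_pow_eq_lintegral {α : Type*} [MeasurableSpace α] {μ : Measure α} (f : α → F)
    {n : ℕ} (hn : n ≠ 0) : eLpNorm f n μ ^ n = ∫⁻ x, ‖f x‖ₑ ^ n ∂μ := by
  have h := eLpNorm_nnreal_pow_eq_lintegral (f := f) (μ := μ) (p := (n : ℝ≥0))
    (by exact_mod_cast hn)
  simpa using h

theorem lintegral_sum_indicator_enorm_pow_le (hΩ : IsOpen Ω) {g : Fin 3 → L2 Ω F} {n : ℕ}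
    (hn : n ≠ 0) {X : ℝ≥0∞} (hg : ∀ i, eLpNorm (g i) n (volume.restrict Ω) ≤ X) :
    ∫⁻ x, (∑ i, ‖Ω.indicator (g i) x‖ₑ) ^ n ≤ 3 ^ n * (3 * X ^ n) := by
  have hm : ∀ i, Measurable fun x => ‖Ω.indicator (g i) x‖ₑ ^ n := fun i =>
    ((Lp.stronglyMeasurable (g i)).indicator hΩ.measurableSet).enorm.pow_const n
  calc ∫⁻ x, (∑ i, ‖Ω.indicator (g i) x‖ₑ) ^ n
      ≤ ∫⁻ x, 3 ^ n * ∑ i, ‖Ω.indicator (g i) x‖ₑ ^ n :=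
        lintegral_mono fun x => ENNReal.sum_fin_three_pow_le _ n
    _ = 3 ^ n * ∑ i, ∫⁻ x, ‖Ω.indicator (g i) x‖ₑ ^ n := by
        rw [lintegral_const_mul' _ _ (by finiteness), lintegral_finsetSum _ fun i _ => hm i]
    _ ≤ 3 ^ n * ∑ _i : Fin 3, X ^ n := by
        gcongr with i
        rw [lintegral_indicator_enorm_pow hΩ _ hn, ← eLpNorm_pow_eq_lintegral _ hn]
        exact pow_le_pow_left' (hg i) n
    _ = _ := by simp

variable [InnerProductSpace ℝ F]

/-- Extension by zero creates no boundary term, because the test functions are still supported in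
`Ω`. -/
theorem hasWeakPartial_iff_indicator (hΩ : IsOpen Ω) {i : Fin 3} {u g : L2 Ω F} :
    HasWeakPartial i u g ↔ IsWeakPartial Ω i (Ω.indicator u) (Ω.indicator g) := by
  have h : ∀ (θ : Space3 → ℝ) (w : L2 Ω F),
      ∫ x, θ x • Ω.indicator w x = ∫ x in Ω, θ x • w x := fun θ w => by
    rw [← integral_indicator hΩ.measurableSet]
    refine integral_congr_ae (.of_forall fun x => ?_)
    by_cases hx : x ∈ Ω <;> simp [hx]
  simp only [HasWeakPartial, IsWeakPartial, h]

theorem IsBoundedC21Domain.isWeakGradient (hΩ : IsBoundedC21Domain Ω) {u : L2 Ω F}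
    {g : Fin 3 → L2 Ω F} (h : ∀ i, HasWeakPartial i u (g i)) :
    IsWeakGradient Ω (Ω.indicator u) fun i => Ω.indicator (g i) where
  measurable := (Lp.stronglyMeasurable u).indicator hΩ.isOpen.measurableSet
  measurable_deriv i := (Lp.stronglyMeasurable (g i)).indicator hΩ.isOpen.measurableSet
  integrable := hΩ.integrable_indicator_L2 u
  integrable_deriv i := hΩ.integrable_indicator_L2 (g i)
  isWeakPartial i := (hasWeakPartial_iff_indicator hΩ.isOpen).1 (h i)

/-- Fourth roots are avoided by means of `K ≤ (K + 1)⁴`. -/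
theorem le_mul_of_pow_four_le {K : ℝ≥0∞} {X y : ℝ≥0∞} (h : y ^ 4 ≤ K * X ^ 4) :
    y ≤ (K + 1) * X := by
  refine (ENNReal.pow_le_pow_left_iff four_ne_zero).1 (h.trans ?_)
  rw [mul_pow]
  gcongr
  exact le_self_add.trans (le_self_pow₀ le_add_self (by norm_num))

variable (F) in
/-- The embedding `H¹ ⊆ L⁴`. -/
theorem IsBoundedC21Domain.exists_eLpNorm_four_le [CompleteSpace F] (hΩ : IsBoundedC21Domain Ω) :
    ∃ C : ℝ≥0, ∀ (u : L2 Ω F) (g : Fin 3 → L2 Ω F), (∀ i, HasWeakPartial i u (g i)) →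
      ∀ X : ℝ≥0∞, ‖u‖ₑ ≤ X → (∀ i, ‖g i‖ₑ ≤ X) → eLpNorm u 4 (volume.restrict Ω) ≤ C * X := by
  obtain ⟨C, hC, hb⟩ := hΩ.sobolevBounds (F := F)
  have hK : C * (1 + (3 ^ 2 * 3) ^ 2) + 1 ≠ ⊤ := by finiteness
  refine ⟨(C * (1 + (3 ^ 2 * 3) ^ 2) + 1).toNNReal, fun u g hug X hu hg => ?_⟩
  rw [ENNReal.coe_toNNReal hK]
  refine le_mul_of_pow_four_le ?_
  have h4 : ∫⁻ x in Ω, ‖u x‖ₑ ^ 4 = ∫⁻ x in Ω, ‖Ω.indicator u x‖ₑ ^ 4 :=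
    setLIntegral_congr_fun hΩ.isOpen.measurableSet fun x hx => by simp [hx]
  have h5 := eLpNorm_pow_eq_lintegral (μ := volume.restrict Ω) (u : Space3 → F) (n := 4)
    (by norm_num)
  have h6 : ∫⁻ x, ‖Ω.indicator u x‖ₑ ^ 2 ≤ X ^ 2 := by
    rw [lintegral_indicator_enorm_pow hΩ.isOpen _ two_ne_zero,
      ← eLpNorm_pow_eq_lintegral _ two_ne_zero]
    refine pow_le_pow_left' ?_ 2
    rwa [Lp.enorm_def] at hu
  have h7 : ∫⁻ x, (∑ i, ‖Ω.indicator (g i) x‖ₑ) ^ 2 ≤ 3 ^ 2 * (3 * X ^ 2) :=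
    lintegral_sum_indicator_enorm_pow_le hΩ.isOpen two_ne_zero fun i => by
      have := hg i
      rwa [Lp.enorm_def] at this
  rw [Nat.cast_ofNat] at h5
  rw [h5, h4]
  refine (hb _ _ (hΩ.isWeakGradient hug)).1.trans ?_
  calc _ ≤ C * ((X ^ 2) ^ 2 + (3 ^ 2 * (3 * X ^ 2)) ^ 2) := by gcongr
    _ = _ := by ring

variable (F) in
/-- The embedding `W^{1,4} ⊆ L^∞`. -/
theorem IsBoundedC21Domain.exists_eLpNorm_top_le [CompleteSpace F] (hΩ : IsBoundedC21Domain Ω) :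
    ∃ C : ℝ≥0, ∀ (u : L2 Ω F) (g : Fin 3 → L2 Ω F), (∀ i, HasWeakPartial i u (g i)) →
      ∀ X : ℝ≥0∞, eLpNorm u 4 (volume.restrict Ω) ≤ X →
        (∀ i, eLpNorm (g i) 4 (volume.restrict Ω) ≤ X) →
          eLpNorm u ⊤ (volume.restrict Ω) ≤ C * X := by
  obtain ⟨C, hC, hb⟩ := hΩ.sobolevBounds (F := F)
  have hK : C * (1 + 3 ^ 4 * 3) + 1 ≠ ⊤ := by finiteness
  refine ⟨(C * (1 + 3 ^ 4 * 3) + 1).toNNReal, fun u g hug X hu hg => ?_⟩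
  rw [ENNReal.coe_toNNReal hK, eLpNorm_exponent_top]
  refine essSup_le_of_ae_le _ ?_
  filter_upwards [(hb _ _ (hΩ.isWeakGradient hug)).2,
    ae_restrict_mem hΩ.isOpen.measurableSet] with x hx hxΩ
  rw [indicator_of_mem hxΩ] at hx
  refine le_mul_of_pow_four_le (hx.trans ?_)
  have h6 : ∫⁻ x, ‖Ω.indicator u x‖ₑ ^ 4 ≤ X ^ 4 := by
    rw [lintegral_indicator_enorm_pow hΩ.isOpen _ four_ne_zero,
      ← eLpNorm_pow_eq_lintegral _ four_ne_zero]
    exact pow_le_pow_left' hu 4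
  have h7 : ∫⁻ x, (∑ i, ‖Ω.indicator (g i) x‖ₑ) ^ 4 ≤ 3 ^ 4 * (3 * X ^ 4) :=
    lintegral_sum_indicator_enorm_pow_le hΩ.isOpen four_ne_zero hg
  calc _ ≤ C * (X ^ 4 + 3 ^ 4 * (3 * X ^ 4)) := by gcongr
    _ = _ := by ring

/-- The weak derivative is unique. -/
theorem HasWeakPartial.unique [CompleteSpace F] (hΩ : IsOpen Ω) {i : Fin 3} {u g g' : L2 Ω F}
    (h : HasWeakPartial i u g) (h' : HasWeakPartial i u g') : g = g' := by
  rw [← sub_eq_zero]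
  have hd : HasWeakPartial i (0 : L2 Ω F) (g - g') := by
    have := h.add (h'.smul (-1))
    simpa [sub_eq_add_neg] using this
  have hl := (memLp_indicator_L2 hΩ (g - g')).locallyIntegrable one_le_two
  have h0 := hΩ.ae_eq_zero_of_integral_contDiff_smul_eq_zero (hl.locallyIntegrableOn Ω)
    fun φ hφ hφc hφs => by
      have h1 := (hasWeakPartial_iff_indicator hΩ).1 hd φ ⟨hφ, hφc, hφs⟩
      have h2 : ∫ x, partialDeriv i φ x • Ω.indicator (0 : L2 Ω F) x = 0 := by
        refine integral_eq_zero_of_ae ?_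
        have := (ae_restrict_iff' hΩ.measurableSet).1
          (Lp.coeFn_zero F 2 (volume.restrict Ω))
        filter_upwards [this] with x hx
        by_cases hxΩ : x ∈ Ω <;> simp [hxΩ]
        right
        simpa using hx hxΩ
      rw [h2] at h1
      exact neg_eq_zero.1 h1.symm
  refine Lp.ext ?_
  refine Filter.EventuallyEq.trans ?_ (Lp.coeFn_zero F 2 (volume.restrict Ω)).symm
  refine (ae_restrict_iff' hΩ.measurableSet).2 ?_
  filter_upwards [h0] with x hx hxΩ
  simpa [hxΩ] using hx hxΩ

theorem H2.hasWeakPartial (u : H2 Ω F) (i : Fin 3) : HasWeakPartial i (H2.val u) (H2.deriv u i) :=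
  u.2.1 i

theorem H2.hasWeakPartial₂ (u : H2 Ω F) (i j : Fin 3) :
    HasWeakPartial j (H2.deriv u i) (H2.deriv₂ u i j) :=
  u.2.2 i j

theorem H1.hasWeakPartial (u : H1 Ω F) (i : Fin 3) : HasWeakPartial i (H1.val u) (H1.deriv u i) :=
  u.2 i

/-- Weak derivatives are unique, so the recorded derivatives carry no extra information. Identities
in `H²` may thus be checked pointwise almost everywhere on the functions alone. -/
theorem H2.ext_of_val [CompleteSpace F] (hΩ : IsOpen Ω) {u v : H2 Ω F}
    (h : H2.val u = H2.val v) : u = v := by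
  have h1 : ∀ i, H2.deriv u i = H2.deriv v i := fun i =>
    (H2.hasWeakPartial u i).unique hΩ (h ▸ H2.hasWeakPartial v i)
  have h2 : ∀ i j, H2.deriv₂ u i j = H2.deriv₂ v i j := fun i j =>
    (H2.hasWeakPartial₂ u i j).unique hΩ (h1 i ▸ H2.hasWeakPartial₂ v i j)
  refine Subtype.ext (PiLp.ext ?_)
  rintro ((⟨⟩ | i) | ⟨i, j⟩)
  exacts [h, h1 i, h2 i j]

theorem H2.enorm_val_le (u : H2 Ω F) : ‖H2.val u‖ₑ ≤ ‖u‖ₑ :=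
  enorm_le_iff_norm_le.2 (PiLp.norm_apply_le u.1 _)

theorem H2.enorm_deriv_le (u : H2 Ω F) (i : Fin 3) : ‖H2.deriv u i‖ₑ ≤ ‖u‖ₑ :=
  enorm_le_iff_norm_le.2 (PiLp.norm_apply_le u.1 _)

theorem H2.enorm_deriv₂_le (u : H2 Ω F) (i j : Fin 3) : ‖H2.deriv₂ u i j‖ₑ ≤ ‖u‖ₑ :=
  enorm_le_iff_norm_le.2 (PiLp.norm_apply_le u.1 _)

variable (F) in
/-- The embeddings `H² ⊆ L^∞` and `H² ⊆ W^{1,4}`. -/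
theorem IsBoundedC21Domain.exists_H2_bounds [CompleteSpace F] (hΩ : IsBoundedC21Domain Ω) :
    ∃ C : ℝ≥0, ∀ u : H2 Ω F, eLpNorm (H2.val u) ⊤ (volume.restrict Ω) ≤ C * ‖u‖ₑ ∧
      eLpNorm (H2.val u) 4 (volume.restrict Ω) ≤ C * ‖u‖ₑ ∧
      ∀ i, eLpNorm (H2.deriv u i) 4 (volume.restrict Ω) ≤ C * ‖u‖ₑ := by
  obtain ⟨C, hC⟩ := hΩ.exists_eLpNorm_four_le F
  obtain ⟨C', hC'⟩ := hΩ.exists_eLpNorm_top_le F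
  have h4 : ∀ u : H2 Ω F, eLpNorm (H2.val u) 4 (volume.restrict Ω) ≤ C * ‖u‖ₑ := fun u =>
    hC _ _ (H2.hasWeakPartial u) _ (H2.enorm_val_le u) (H2.enorm_deriv_le u)
  have h4' : ∀ (u : H2 Ω F) i, eLpNorm (H2.deriv u i) 4 (volume.restrict Ω) ≤ C * ‖u‖ₑ :=
    fun u i => hC _ _ (H2.hasWeakPartial₂ u i) _ (H2.enorm_deriv_le u i) (H2.enorm_deriv₂_le u i)
  refine ⟨C' * C + C, fun u => ⟨?_, ?_, fun i => ?_⟩⟩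
  · refine (hC' _ _ (H2.hasWeakPartial u) _ (h4 u) (h4' u)).trans ?_
    rw [← mul_assoc, ENNReal.coe_add, ENNReal.coe_mul]
    gcongr
    exact le_self_add
  · refine (h4 u).trans ?_
    gcongr
    exact le_add_self
  · refine (h4' u i).trans ?_
    gcongr
    exact le_add_self

end SobolevEmbedding

/-! ### Products in `H²` and `H¹`. -/

section Products

open scoped ENNReal NNReal

variable {Ω : Set Space3} {F₁ F₂ F₃ : Type*} [NormedAddCommGroup F₁] [InnerProductSpace ℝ F₁]
  [NormedAddCommGroup F₂] [InnerProductSpace ℝ F₂] [NormedAddCommGroup F₃]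
  [InnerProductSpace ℝ F₃] (B : F₁ →L[ℝ] F₂ →L[ℝ] F₃)

/-- Hölder's inequality for a bilinear map with values in `L²`. -/
theorem exists_bilin_L2 (p q : ℝ≥0∞) [ENNReal.HolderTriple p q 2] {f : L2 Ω F₁} {g : L2 Ω F₂}
    {a b : ℝ≥0} (hf : eLpNorm f p (volume.restrict Ω) ≤ a)
    (hg : eLpNorm g q (volume.restrict Ω) ≤ b) :
    ∃ P : L2 Ω F₃, (P =ᵐ[volume.restrict Ω] fun x => B (f x) (g x)) ∧ ‖P‖ ≤ ‖B‖ * a * b := by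
  have hf' : MemLp f p (volume.restrict Ω) :=
    ⟨(Lp.memLp f).1, hf.trans_lt ENNReal.coe_lt_top⟩
  have hg' : MemLp g q (volume.restrict Ω) :=
    ⟨(Lp.memLp g).1, hg.trans_lt ENNReal.coe_lt_top⟩
  refine ⟨(B.memLp_of_bilin 2 hf' hg').toLp, MemLp.coeFn_toLp _, ?_⟩
  rw [Lp.norm_toLp]
  refine ENNReal.toReal_le_of_le_ofReal (by positivity) ?_
  calc eLpNorm (fun x => B (f x) (g x)) 2 (volume.restrict Ω)
      ≤ ‖B‖₊ * eLpNorm f p (volume.restrict Ω) * eLpNorm g q (volume.restrict Ω) :=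
        eLpNorm_le_eLpNorm_mul_eLpNorm_of_nnnorm hf'.1 hg'.1 (B · ·) ‖B‖₊
          (.of_forall fun _ => B.le_opNorm₂ _ _)
    _ ≤ ‖B‖₊ * a * b := by gcongr
    _ = ENNReal.ofReal (‖B‖ * a * b) := by
        rw [← ENNReal.coe_mul, ← ENNReal.coe_mul, ENNReal.ofReal, ENNReal.coe_inj]
        ext
        rw [Real.coe_toNNReal _ (by positivity)]
        simp

/-- The product rule for weak derivatives of `L²` functions. -/
theorem IsBoundedC21Domain.hasWeakPartial_bilin [CompleteSpace F₁] [CompleteSpace F₂]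
    [CompleteSpace F₃] (hΩ : IsBoundedC21Domain Ω) {i : Fin 3} {f f' : L2 Ω F₁} {g g' : L2 Ω F₂}
    {P Q : L2 Ω F₃} (hf : HasWeakPartial i f f') (hg : HasWeakPartial i g g')
    (hP : P =ᵐ[volume.restrict Ω] fun x => B (f x) (g x))
    (hQ : Q =ᵐ[volume.restrict Ω] fun x => B (f' x) (g x) + B (f x) (g' x)) :
    HasWeakPartial i P Q := by
  have hΩm := hΩ.isOpen.measurableSet
  have key := IsWeakPartial.bilin B hΩ.isOpen (hΩ.integrable_indicator_L2 f)
    (hΩ.integrable_indicator_L2 f') (hΩ.integrable_indicator_L2 g)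
    (hΩ.integrable_indicator_L2 g') (memLp_indicator_L2 hΩ.isOpen f)
    (memLp_indicator_L2 hΩ.isOpen f') (memLp_indicator_L2 hΩ.isOpen g)
    (memLp_indicator_L2 hΩ.isOpen g') ((hasWeakPartial_iff_indicator hΩ.isOpen).1 hf)
    ((hasWeakPartial_iff_indicator hΩ.isOpen).1 hg)
  rw [hasWeakPartial_iff_indicator hΩ.isOpen]
  intro φ hφ
  have hP' : ∀ᵐ x, Ω.indicator P x = B (Ω.indicator f x) (Ω.indicator g x) := by
    filter_upwards [(ae_restrict_iff' hΩm).1 hP] with x hx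
    by_cases hxΩ : x ∈ Ω
    · simpa [hxΩ] using hx hxΩ
    · simp [hxΩ]
  have hQ' : ∀ᵐ x, Ω.indicator Q x = B (Ω.indicator f' x) (Ω.indicator g x) +
      B (Ω.indicator f x) (Ω.indicator g' x) := by
    filter_upwards [(ae_restrict_iff' hΩm).1 hQ] with x hx
    by_cases hxΩ : x ∈ Ω
    · simpa [hxΩ] using hx hxΩ
    · simp [hxΩ]
  have h1 := integral_congr_ae (hP'.mono fun x hx =>
    congrArg (fun w => partialDeriv i φ x • w) hx)
  have h2 := integral_congr_ae (hQ'.mono fun x hx => congrArg (fun w => φ x • w) hx)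
  rw [h1, h2]
  exact key φ hφ

theorem holderTriple_four_four_two : ENNReal.HolderTriple 4 4 2 := by
  constructor
  rw [← two_mul, show (4 : ℝ≥0∞) = 2 * 2 by norm_num,
    ENNReal.mul_inv (by norm_num) (by norm_num), ← mul_assoc,
    ENNReal.mul_inv_cancel (by norm_num) (by norm_num), one_mul]

theorem norm_piLp_index2_le {F : Type*} [NormedAddCommGroup F]
    {U : PiLp 2 fun _ : Index2 => L2 Ω F} {M : ℝ} (h : ∀ a, ‖U a‖ ≤ M) : ‖U‖ ≤ 4 * M := by
  have hM : 0 ≤ M := (norm_nonneg _).trans (h (.inl (.inl ())))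
  refine le_of_sq_le_sq ?_ (by positivity)
  rw [PiLp.norm_sq_eq_of_L2]
  calc ∑ a, ‖U a‖ ^ 2 ≤ ∑ _a : Index2, M ^ 2 :=
        Finset.sum_le_sum fun a _ => pow_le_pow_left₀ (norm_nonneg _) (h a) 2
    -- There are `1 + 3 + 9 = 13` derivatives of order at most two, and `13 ≤ 4²`.
    _ = 13 * M ^ 2 := by simp
    _ ≤ (4 * M) ^ 2 := by nlinarith [sq_nonneg M]

variable [CompleteSpace F₁] [CompleteSpace F₂] [CompleteSpace F₃]

/-- Products of functions of class `H²` are of class `H²`. -/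
theorem IsBoundedC21Domain.exists_H2_bilin (hΩ : IsBoundedC21Domain Ω) :
    ∃ K : ℝ, ∀ (u : H2 Ω F₁) (v : H2 Ω F₂), ∃ w : H2 Ω F₃,
      (H2.val w =ᵐ[volume.restrict Ω] fun x => B (H2.val u x) (H2.val v x)) ∧
      (∀ i, H2.deriv w i =ᵐ[volume.restrict Ω] fun x =>
        B (H2.deriv u i x) (H2.val v x) + B (H2.val u x) (H2.deriv v i x)) ∧
      (∀ i j, H2.deriv₂ w i j =ᵐ[volume.restrict Ω] fun x =>
        (B (H2.deriv₂ u i j x) (H2.val v x) + B (H2.deriv u i x) (H2.deriv v j x)) +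
        (B (H2.deriv u j x) (H2.deriv v i x) + B (H2.val u x) (H2.deriv₂ v i j x))) ∧
      ‖w‖ ≤ K * ‖u‖ * ‖v‖ := by
  have := holderTriple_four_four_two
  obtain ⟨C₁, hC₁⟩ := hΩ.exists_H2_bounds F₁
  obtain ⟨C₂, hC₂⟩ := hΩ.exists_H2_bounds F₂
  -- One factor `4` comes from the number of components, the other from the four terms of a second
  -- derivative. Adding `1` to `C₁` and `C₂` lets the single numbers `a` and `b` bound both the `L²`
  -- norms and the Sobolev norms.
  refine ⟨16 * ‖B‖ * (C₁ + 1) * (C₂ + 1), fun u v => ?_⟩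
  obtain ⟨hu, -, hu'⟩ := hC₁ u
  obtain ⟨hv, -, hv'⟩ := hC₂ v
  set a : ℝ≥0 := (C₁ + 1) * ‖u‖₊ with ha
  set b : ℝ≥0 := (C₂ + 1) * ‖v‖₊ with hb
  have hle : ∀ {C d : ℝ≥0} {y : ℝ≥0∞}, y ≤ C * (d : ℝ≥0∞) →
      y ≤ (((C + 1) * d : ℝ≥0) : ℝ≥0∞) := fun {C d y} h => by
    refine h.trans ?_
    rw [← ENNReal.coe_mul, ENNReal.coe_le_coe]
    gcongr
    exact le_self_add
  have hle1 : ∀ {C d : ℝ≥0} {y : ℝ≥0∞}, y ≤ (d : ℝ≥0∞) →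
      y ≤ (((C + 1) * d : ℝ≥0) : ℝ≥0∞) := fun {C d y} h => by
    refine h.trans ?_
    rw [ENNReal.coe_le_coe]
    exact le_mul_of_one_le_left zero_le le_add_self
  have hu2 : ∀ i j, eLpNorm (H2.deriv₂ u i j) 2 (volume.restrict Ω) ≤ a := fun i j =>
    hle1 ((Lp.enorm_def _).ge.trans (H2.enorm_deriv₂_le u i j))
  have hv2 : ∀ i j, eLpNorm (H2.deriv₂ v i j) 2 (volume.restrict Ω) ≤ b := fun i j =>
    hle1 ((Lp.enorm_def _).ge.trans (H2.enorm_deriv₂_le v i j))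
  have hu1 : ∀ i, eLpNorm (H2.deriv u i) 2 (volume.restrict Ω) ≤ a := fun i =>
    hle1 ((Lp.enorm_def _).ge.trans (H2.enorm_deriv_le u i))
  have hv1 : ∀ i, eLpNorm (H2.deriv v i) 2 (volume.restrict Ω) ≤ b := fun i =>
    hle1 ((Lp.enorm_def _).ge.trans (H2.enorm_deriv_le v i))
  have hu0 : eLpNorm (H2.val u) 2 (volume.restrict Ω) ≤ a :=
    hle1 ((Lp.enorm_def _).ge.trans (H2.enorm_val_le u))
  -- An undifferentiated factor beside a derivative is taken in `L^∞`; two first derivatives are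
  -- both taken in `L⁴`.
  obtain ⟨P, hP, hPn⟩ := exists_bilin_L2 B 2 ⊤ hu0 (hle hv)
  choose A hA hAn using fun i => exists_bilin_L2 B 2 ⊤ (hu1 i) (hle hv)
  choose A' hA' hAn' using fun i => exists_bilin_L2 B ⊤ 2 (hle hu) (hv1 i)
  choose D hD hDn using fun i j => exists_bilin_L2 B 2 ⊤ (hu2 i j) (hle hv)
  choose G hG hGn using fun i j => exists_bilin_L2 B 4 4 (hle (hu' i)) (hle (hv' j))
  choose D' hD' hDn' using fun i j => exists_bilin_L2 B ⊤ 2 (hle hu) (hv2 i j)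
  have hAA : ∀ i, (A i + A' i : L2 Ω F₃) =ᵐ[volume.restrict Ω] fun x =>
      B (H2.deriv u i x) (H2.val v x) + B (H2.val u x) (H2.deriv v i x) := fun i => by
    filter_upwards [Lp.coeFn_add (A i) (A' i), hA i, hA' i] with x h1 h2 h3
    rw [h1, Pi.add_apply, h2, h3]
  have hDG : ∀ i j, (D i j + G i j : L2 Ω F₃) =ᵐ[volume.restrict Ω] fun x =>
      B (H2.deriv₂ u i j x) (H2.val v x) + B (H2.deriv u i x) (H2.deriv v j x) := fun i j => by
    filter_upwards [Lp.coeFn_add (D i j) (G i j), hD i j, hG i j] with x h1 h2 h3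
    rw [h1, Pi.add_apply, h2, h3]
  have hGD : ∀ i j, (G j i + D' i j : L2 Ω F₃) =ᵐ[volume.restrict Ω] fun x =>
      B (H2.deriv u j x) (H2.deriv v i x) + B (H2.val u x) (H2.deriv₂ v i j x) := fun i j => by
    filter_upwards [Lp.coeFn_add (G j i) (D' i j), hG j i, hD' i j] with x h1 h2 h3
    rw [h1, Pi.add_apply, h2, h3]
  let W : PiLp 2 fun _ : Index2 => L2 Ω F₃ := WithLp.toLp 2 fun
    | .inl (.inl _) => P
    | .inl (.inr i) => A i + A' i
    | .inr (i, j) => (D i j + G i j) + (G j i + D' i j)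
  have hW : W ∈ H2 Ω F₃ := by
    refine ⟨fun i => ?_, fun i j => ?_⟩
    · exact hΩ.hasWeakPartial_bilin B (H2.hasWeakPartial u i) (H2.hasWeakPartial v i) hP (hAA i)
    · exact (hΩ.hasWeakPartial_bilin B (H2.hasWeakPartial₂ u i j) (H2.hasWeakPartial v j)
        (hA i) (hDG i j)).add (hΩ.hasWeakPartial_bilin B (H2.hasWeakPartial u j)
        (H2.hasWeakPartial₂ v i j) (hA' i) (hGD i j))
  refine ⟨⟨W, hW⟩, hP, hAA, fun i j => ?_, ?_⟩
  · refine (Lp.coeFn_add (D i j + G i j) (G j i + D' i j)).trans ?_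
    filter_upwards [hDG i j, hGD i j] with x h1 h2
    rw [Pi.add_apply, h1, h2]
  · have hab : (0 : ℝ) ≤ ‖B‖ * a * b := by positivity
    have hn : ‖W‖ ≤ 4 * (4 * (‖B‖ * a * b)) := by
      refine norm_piLp_index2_le ?_
      rintro ((⟨⟩ | i) | ⟨i, j⟩)
      · exact hPn.trans (by linarith)
      · refine (norm_add_le (A i) (A' i)).trans ?_
        linarith [hAn i, hAn' i]
      · refine (norm_add_le (D i j + G i j) (G j i + D' i j)).trans ?_
        linarith [norm_add_le (D i j) (G i j), norm_add_le (G j i) (D' i j), hDn i j, hGn i j,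
          hGn j i, hDn' i j]
    refine (show ‖(⟨W, hW⟩ : H2 Ω F₃)‖ = ‖W‖ from rfl).trans_le (hn.trans (le_of_eq ?_))
    rw [ha, hb]
    push_cast
    ring

/-- Products of functions of class `H¹` and of class `H²` are of class `H¹`. -/
theorem IsBoundedC21Domain.exists_H1_bilin (hΩ : IsBoundedC21Domain Ω) (u : H1 Ω F₁)
    (v : H2 Ω F₂) : ∃ w : H1 Ω F₃,
      (H1.val w =ᵐ[volume.restrict Ω] fun x => B (H1.val u x) (H2.val v x)) ∧
      (∀ i, H1.deriv w i =ᵐ[volume.restrict Ω] fun x =>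
        B (H1.deriv u i x) (H2.val v x) + B (H1.val u x) (H2.deriv v i x)) := by
  have := holderTriple_four_four_two
  obtain ⟨C₁, hC₁⟩ := hΩ.exists_eLpNorm_four_le F₁
  obtain ⟨C₂, hC₂⟩ := hΩ.exists_H2_bounds F₂
  obtain ⟨hv, -, hv'⟩ := hC₂ v
  have hu4 : eLpNorm (H1.val u) 4 (volume.restrict Ω) ≤ (C₁ * ‖u‖₊ : ℝ≥0) := by
    refine (hC₁ _ _ (H1.hasWeakPartial u) ‖u‖ₑ ?_ fun i => ?_).trans_eq (by simp; rfl)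
    · exact enorm_le_iff_norm_le.2 (PiLp.norm_apply_le u.1 _)
    · exact enorm_le_iff_norm_le.2 (PiLp.norm_apply_le u.1 _)
  have hvt : eLpNorm (H2.val v) ⊤ (volume.restrict Ω) ≤ (C₂ * ‖v‖₊ : ℝ≥0) :=
    hv.trans_eq (by simp; rfl)
  have hv4 : ∀ i, eLpNorm (H2.deriv v i) 4 (volume.restrict Ω) ≤ (C₂ * ‖v‖₊ : ℝ≥0) := fun i =>
    (hv' i).trans_eq (by simp; rfl)
  have h2 : ∀ f : L2 Ω F₁, eLpNorm f 2 (volume.restrict Ω) ≤ (‖f‖₊ : ℝ≥0∞) := fun f =>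
    (Lp.enorm_def f).ge
  obtain ⟨P, hP, -⟩ := exists_bilin_L2 B 2 ⊤ (h2 (H1.val u)) hvt
  choose A hA _ using fun i => exists_bilin_L2 B 2 ⊤ (h2 (H1.deriv u i)) hvt
  choose A' hA' _ using fun i => exists_bilin_L2 B 4 4 hu4 (hv4 i)
  have hAA : ∀ i, (A i + A' i : L2 Ω F₃) =ᵐ[volume.restrict Ω] fun x =>
      B (H1.deriv u i x) (H2.val v x) + B (H1.val u x) (H2.deriv v i x) := fun i => by
    filter_upwards [Lp.coeFn_add (A i) (A' i), hA i, hA' i] with x h1 h2 h3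
    rw [h1, Pi.add_apply, h2, h3]
  let W : PiLp 2 fun _ : Index1 => L2 Ω F₃ := WithLp.toLp 2 fun
    | .inl _ => P
    | .inr i => A i + A' i
  have hW : W ∈ H1 Ω F₃ := fun i =>
    hΩ.hasWeakPartial_bilin B (H1.hasWeakPartial u i) (H2.hasWeakPartial v i) hP (hAA i)
  exact ⟨⟨W, hW⟩, hP, hAA⟩

end Products

/-! ### Products and the Neumann condition. -/

section Neumann

variable {Ω : Set Space3} {F₁ F₂ F₃ : Type*} [NormedAddCommGroup F₁] [InnerProductSpace ℝ F₁]
  [NormedAddCommGroup F₂] [InnerProductSpace ℝ F₂] [NormedAddCommGroup F₃]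
  [InnerProductSpace ℝ F₃] (B : F₁ →L[ℝ] F₂ →L[ℝ] F₃)

theorem integrable_smul_L2 {F : Type*} [NormedAddCommGroup F] [InnerProductSpace ℝ F]
    (f : L2 Ω ℝ) (g : L2 Ω F) : Integrable (fun x => f x • g x) (volume.restrict Ω) :=
  memLp_one_iff_integrable.1 ((Lp.memLp g).smul (Lp.memLp f))

/-- The homogeneous Neumann condition for `u`, tested with `φ v`. -/
theorem IsBoundedC21Domain.neumann_bilin [CompleteSpace F₁] [FiniteDimensional ℝ F₂]
    [CompleteSpace F₃] (hΩ : IsBoundedC21Domain Ω) {u : H2 Ω F₁} (hu : u ∈ H2N Ω F₁)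
    (v : H2 Ω F₂) (φ : H1 Ω ℝ) :
    (∀ i, Integrable (fun x => H1.val φ x • B (H2.deriv₂ u i i x) (H2.val v x) +
      (H1.deriv φ i x • B (H2.deriv u i x) (H2.val v x) +
        H1.val φ x • B (H2.deriv u i x) (H2.deriv v i x))) (volume.restrict Ω)) ∧
    ∑ i, ∫ x in Ω, (H1.val φ x • B (H2.deriv₂ u i i x) (H2.val v x) +
      (H1.deriv φ i x • B (H2.deriv u i x) (H2.val v x) +
        H1.val φ x • B (H2.deriv u i x) (H2.deriv v i x))) = 0 := by
  have := FiniteDimensional.complete ℝ F₂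
  -- The Neumann condition is tested with scalar functions only. So `v` is expanded in an
  -- orthonormal basis, each `φ ⟨b k, v⟩` is an admissible test function in `H¹`, and the resulting
  -- identities are mapped by `B(·, b k)` and summed.
  let b := stdOrthonormalBasis ℝ F₂
  let ℓ : ∀ k, ℝ →L[ℝ] F₂ →L[ℝ] ℝ := fun k =>
    (ContinuousLinearMap.lsmul ℝ ℝ).bilinearComp (ContinuousLinearMap.id ℝ ℝ) (innerSL ℝ (b k))
  have hℓ : ∀ k a y, ℓ k a y = a * inner ℝ (b k) y := fun k a y => rfl
  choose ψ hψ hψ' using fun k => hΩ.exists_H1_bilin (ℓ k) φ v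
  have hbsum : ∀ (L : F₂ →L[ℝ] F₃) (y : F₂), ∑ k, inner ℝ (b k) y • L (b k) = L y := fun L y => by
    conv_rhs => rw [← b.sum_repr' y]
    simp
  have i1 : ∀ i k, Integrable (fun x => H1.val (ψ k) x • H2.deriv₂ u i i x)
      (volume.restrict Ω) := fun i k => integrable_smul_L2 _ _
  have i2 : ∀ i k, Integrable (fun x => H1.deriv (ψ k) i x • H2.deriv u i x)
      (volume.restrict Ω) := fun i k => integrable_smul_L2 _ _
  have i3 : ∀ i k, Integrable (fun x => B.flip (b k) (H1.val (ψ k) x • H2.deriv₂ u i i x +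
      H1.deriv (ψ k) i x • H2.deriv u i x)) (volume.restrict Ω) := fun i k =>
    (B.flip (b k)).integrable_comp ((i1 i k).add (i2 i k))
  have hae : ∀ i, (fun x => ∑ k, B.flip (b k) (H1.val (ψ k) x • H2.deriv₂ u i i x +
      H1.deriv (ψ k) i x • H2.deriv u i x)) =ᵐ[volume.restrict Ω] fun x =>
      H1.val φ x • B (H2.deriv₂ u i i x) (H2.val v x) +
      (H1.deriv φ i x • B (H2.deriv u i x) (H2.val v x) +
        H1.val φ x • B (H2.deriv u i x) (H2.deriv v i x)) := fun i => by
    filter_upwards [ae_all_iff.2 hψ, ae_all_iff.2 fun k => hψ' k i] with x h1 h2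
    simp only [h1, h2, hℓ, map_add, map_smul, ContinuousLinearMap.flip_apply, add_smul, mul_smul,
      Finset.sum_add_distrib, ← Finset.smul_sum, hbsum]
  refine ⟨fun i => (integrable_finsetSum _ fun k _ => i3 i k).congr (hae i), ?_⟩
  have hzero : ∀ k, ∑ i, ∫ x in Ω, B.flip (b k) (H1.val (ψ k) x • H2.deriv₂ u i i x +
      H1.deriv (ψ k) i x • H2.deriv u i x) = 0 := fun k => by
    have h0 := congrArg (B.flip (b k)) (hu (ψ k))
    rw [normalDerivative, map_sum, map_zero] at h0
    rw [← h0]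
    refine Finset.sum_congr rfl fun i _ => ?_
    rw [← integral_add (i1 i k) (i2 i k)]
    exact ContinuousLinearMap.integral_comp_comm _ ((i1 i k).add (i2 i k))
  calc _ = ∑ i, ∑ k, ∫ x in Ω, B.flip (b k) (H1.val (ψ k) x • H2.deriv₂ u i i x +
        H1.deriv (ψ k) i x • H2.deriv u i x) := by
        refine Finset.sum_congr rfl fun i _ => ?_
        rw [← integral_finsetSum _ fun k _ => i3 i k]
        exact integral_congr_ae (hae i).symm
    _ = 0 := by
        rw [Finset.sum_comm]
        exact Finset.sum_eq_zero fun k _ => hzero k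

/-- Products of functions with vanishing normal derivative have vanishing normal derivative. -/
theorem IsBoundedC21Domain.exists_H2N_bilin [FiniteDimensional ℝ F₁] [FiniteDimensional ℝ F₂]
    [CompleteSpace F₃] (hΩ : IsBoundedC21Domain Ω) :
    ∃ K : ℝ, ∀ (u : H2N Ω F₁) (v : H2N Ω F₂), ∃ w : H2N Ω F₃,
      (H2N.val w =ᵐ[volume.restrict Ω] fun x => B (H2N.val u x) (H2N.val v x)) ∧
      ‖w‖ ≤ K * ‖u‖ * ‖v‖ := by
  have := FiniteDimensional.complete ℝ F₁
  have := FiniteDimensional.complete ℝ F₂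
  obtain ⟨K, hK⟩ := hΩ.exists_H2_bilin B
  refine ⟨K, fun u v => ?_⟩
  obtain ⟨w, hw, hw1, hw2, hwn⟩ := hK u.1 v.1
  refine ⟨⟨w, fun φ => ?_⟩, hw, hwn⟩
  -- The Laplacian of `B(u, v)` contains each cross term `B(∂ᵢu, ∂ᵢv)` twice. One copy belongs to
  -- the condition for `u` tested with `φ v`, the other to that for `v` tested with `φ u`; the sum
  -- of the two is the condition for the product.
  obtain ⟨j1, e1⟩ := hΩ.neumann_bilin B u.2 v.1 φ
  obtain ⟨j2, e2⟩ := hΩ.neumann_bilin B.flip v.2 u.1 φ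
  rw [← (congrArg₂ (· + ·) e1 e2).trans (add_zero (0 : F₃)), normalDerivative]
  rw [← Finset.sum_add_distrib]
  refine Finset.sum_congr rfl fun i _ => ?_
  rw [← integral_add (integrable_smul_L2 _ _) (integrable_smul_L2 _ _),
    ← integral_add (j1 i) (j2 i)]
  refine integral_congr_ae ?_
  filter_upwards [hw1 i, hw2 i i] with x h1 h2
  rw [h1, h2]
  simp only [ContinuousLinearMap.flip_apply, smul_add]
  abel

theorem H2N.ext_of_val {F : Type*} [NormedAddCommGroup F] [InnerProductSpace ℝ F]
    [CompleteSpace F] (hΩ : IsOpen Ω) {u v : H2N Ω F}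
    (h : H2N.val u =ᵐ[volume.restrict Ω] H2N.val v) : u = v :=
  Subtype.ext (H2.ext_of_val hΩ (Lp.ext h))

theorem H2N.val_add {F : Type*} [NormedAddCommGroup F] [InnerProductSpace ℝ F] (u v : H2N Ω F) :
    ∀ᵐ x ∂volume.restrict Ω, H2N.val (u + v) x = H2N.val u x + H2N.val v x :=
  Lp.coeFn_add (H2N.val u) (H2N.val v)

theorem H2N.val_smul {F : Type*} [NormedAddCommGroup F] [InnerProductSpace ℝ F] (c : ℝ)
    (u : H2N Ω F) : ∀ᵐ x ∂volume.restrict Ω, H2N.val (c • u) x = c • H2N.val u x :=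
  Lp.coeFn_smul c (H2N.val u)

/-- Pointwise application of a bilinear map is a bounded bilinear map on `H²_N`. -/
theorem IsBoundedC21Domain.exists_H2N_boundedBilin [FiniteDimensional ℝ F₁]
    [FiniteDimensional ℝ F₂] [CompleteSpace F₃] (hΩ : IsBoundedC21Domain Ω) :
    ∃ m : H2N Ω F₁ → H2N Ω F₂ → H2N Ω F₃, IsBoundedBilin m ∧
      ∀ u v, H2N.val (m u v) =ᵐ[volume.restrict Ω] fun x => B (H2N.val u x) (H2N.val v x) := by
  obtain ⟨K, hK⟩ := hΩ.exists_H2N_bilin B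
  choose m hm hmn using hK
  have h₁ : ∀ u u' v, m (u + u') v = m u v + m u' v := fun u u' v => by
    refine H2N.ext_of_val hΩ.isOpen ?_
    filter_upwards [hm (u + u') v, hm u v, hm u' v, H2N.val_add (m u v) (m u' v),
      H2N.val_add u u'] with x h1 h2 h3 h4 h5
    rw [h1, h4, h2, h3, h5, map_add, add_apply]
  have h₂ : ∀ (c : ℝ) u v, m (c • u) v = c • m u v := fun c u v => by
    refine H2N.ext_of_val hΩ.isOpen ?_
    filter_upwards [hm (c • u) v, hm u v, H2N.val_smul c (m u v), H2N.val_smul c u]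
      with x h1 h2 h3 h4
    rw [h1, h3, h2, h4, map_smul, smul_apply]
  have h₃ : ∀ u v v', m u (v + v') = m u v + m u v' := fun u v v' => by
    refine H2N.ext_of_val hΩ.isOpen ?_
    filter_upwards [hm u (v + v'), hm u v, hm u v', H2N.val_add (m u v) (m u v'),
      H2N.val_add v v'] with x h1 h2 h3 h4 h5
    rw [h1, h4, h2, h3, h5, map_add]
  have h₄ : ∀ (c : ℝ) u v, m u (c • v) = c • m u v := fun c u v => by
    refine H2N.ext_of_val hΩ.isOpen ?_
    filter_upwards [hm u (c • v), hm u v, H2N.val_smul c (m u v), H2N.val_smul c v]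
      with x h1 h2 h3 h4
    rw [h1, h3, h2, h4, map_smul]
  exact ⟨m, ⟨h₁, h₂, h₃, h₄, K, hmn⟩, hm⟩

end Neumann

/-! ### Completeness of `H²_N`. -/

section Completeness

variable {Ω : Set Space3} {F : Type*} [NormedAddCommGroup F] [InnerProductSpace ℝ F]
  [CompleteSpace F]

/-- Weak derivatives and the Neumann condition are equalities between such pairings, hence closed
conditions. -/
theorem continuous_integral_smul_L2 {f : Space3 → ℝ} (hf : MemLp f 2 (volume.restrict Ω)) :
    Continuous fun u : L2 Ω F => ∫ x in Ω, f x • u x := by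
  have h := ((ContinuousLinearMap.lsmul ℝ ℝ : ℝ →L[ℝ] F →L[ℝ] F).lpPairing
    (volume.restrict Ω) 2 2 (hf.toLp f)).continuous
  refine h.congr fun u => ?_
  rw [ContinuousLinearMap.lpPairing_eq_integral]
  refine integral_congr_ae ?_
  filter_upwards [hf.coeFn_toLp] with x hx
  simp [hx]

theorem isClosed_hasWeakPartial {X : Type*} [TopologicalSpace X] (i : Fin 3) {u g : X → L2 Ω F}
    (hu : Continuous u) (hg : Continuous g) : IsClosed {x | HasWeakPartial i (u x) (g x)} := by
  unfold HasWeakPartial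
  simp only [ofPred_forall]
  refine isClosed_iInter fun φ => isClosed_iInter fun hφ => isClosed_eq ?_ ?_
  · exact (continuous_integral_smul_L2 (hφ.memLp_partialDeriv i)).comp hu
  · exact ((continuous_integral_smul_L2 hφ.memLp).comp hg).neg

theorem isClosed_H2 : IsClosed (H2 Ω F : Set (PiLp 2 fun _ : Index2 => L2 Ω F)) := by
  have h : ∀ a, Continuous fun U : PiLp 2 fun _ : Index2 => L2 Ω F => U a := fun a =>
    PiLp.continuous_apply 2 _ a
  change IsClosed {U : PiLp 2 fun _ : Index2 => L2 Ω F |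
    (∀ i, HasWeakPartial i (U (.inl (.inl ()))) (U (.inl (.inr i)))) ∧
    ∀ i j, HasWeakPartial j (U (.inl (.inr i))) (U (.inr (i, j)))}
  simp only [ofPred_and, ofPred_forall]
  exact (isClosed_iInter fun i => isClosed_hasWeakPartial i (h _) (h _)).inter
    (isClosed_iInter fun i => isClosed_iInter fun j => isClosed_hasWeakPartial j (h _) (h _))

theorem isClosed_H2N : IsClosed (H2N Ω F : Set (H2 Ω F)) := by
  have h : ∀ a, Continuous fun U : H2 Ω F => U.1 a := fun a =>
    (PiLp.continuous_apply 2 _ a).comp continuous_subtype_val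
  change IsClosed {u : H2 Ω F | ∀ φ : H1 Ω ℝ, normalDerivative u φ = 0}
  simp only [ofPred_forall]
  refine isClosed_iInter fun φ => isClosed_eq ?_ continuous_const
  unfold normalDerivative
  exact continuous_finsetSum _ fun i _ =>
    ((continuous_integral_smul_L2 (Lp.memLp (H1.val φ))).comp (h _)).add
      ((continuous_integral_smul_L2 (Lp.memLp (H1.deriv φ i))).comp (h _))

theorem completeSpace_H2 : CompleteSpace (H2 Ω F) := isClosed_H2.completeSpace_coe

/-- Completeness is what the inverse function theorem requires of `H²_N`. -/
theorem completeSpace_H2N : CompleteSpace (H2N Ω F) :=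
  have := completeSpace_H2 (Ω := Ω) (F := F)
  isClosed_H2N.completeSpace_coe

end Completeness

end

/-! ### Unit maps as a quadric. -/

theorem mainTheorem9 (Ω : Set Space3) (hΩ : IsBoundedC21Domain Ω) :
    IsSmoothSubmanifold (unitMaps Ω) ∧
    ∀ u₀ ∈ unitMaps Ω, tangentSpaceAt (unitMaps Ω) u₀ =
      {u : H2N Ω Space3 | ∀ᵐ x ∂volume.restrict Ω, inner ℝ (H2N.val u x) (H2N.val u₀ x) = 0} := by
  obtain ⟨dot, hdotb, hdot⟩ := hΩ.exists_H2N_boundedBilin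
    (innerSL ℝ : Space3 →L[ℝ] Space3 →L[ℝ] ℝ)
  have hdot : ∀ u v, H2N.val (dot u v) =ᵐ[volume.restrict Ω] fun x =>
    inner ℝ (H2N.val u x) (H2N.val v x) := hdot
  obtain ⟨act, hactb, hact⟩ := hΩ.exists_H2N_boundedBilin
    (ContinuousLinearMap.lsmul ℝ ℝ : ℝ →L[ℝ] Space3 →L[ℝ] Space3)
  have hact : ∀ a u, H2N.val (act a u) =ᵐ[volume.restrict Ω] fun x =>
    H2N.val a x • H2N.val u x := hact
  have hsymm : ∀ u v, dot u v = dot v u := fun u v => by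
    refine H2N.ext_of_val hΩ.isOpen ?_
    filter_upwards [hdot u v, hdot v u] with x h1 h2
    rw [h1, h2, real_inner_comm]
  -- All three identities hold pointwise because `|u₀| = 1`. The element `dot u₀ u₀` plays the part
  -- of the constant function `1`.
  have hunit : ∀ u₀ ∈ unitMaps Ω, (∀ u, u ∈ unitMaps Ω ↔ dot u u = dot u₀ u₀) ∧
      (∀ a, dot (act a u₀) u₀ = a) ∧ act (dot u₀ u₀) u₀ = u₀ := by
    intro u₀ hu₀
    have hu₀' : ∀ᵐ x ∂volume.restrict Ω, ‖H2N.val u₀ x‖ = 1 := hu₀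
    refine ⟨fun u => ⟨fun hu => ?_, fun hu => ?_⟩, fun a => ?_, ?_⟩
    · have hu' : ∀ᵐ x ∂volume.restrict Ω, ‖H2N.val u x‖ = 1 := hu
      refine H2N.ext_of_val hΩ.isOpen ?_
      filter_upwards [hdot u u, hdot u₀ u₀, hu₀', hu'] with x h1 h2 h3 h4
      rw [h1, h2, real_inner_self_eq_norm_sq, real_inner_self_eq_norm_sq, h3, h4]
    · have h1 := hdot u u
      rw [hu] at h1
      change ∀ᵐ x ∂volume.restrict Ω, ‖H2N.val u x‖ = 1
      filter_upwards [h1, hdot u₀ u₀, hu₀'] with x h1 h2 h3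
      rw [h2, real_inner_self_eq_norm_sq, real_inner_self_eq_norm_sq, h3] at h1
      exact (sq_eq_sq₀ (norm_nonneg _) zero_le_one).1 h1.symm
    · refine H2N.ext_of_val hΩ.isOpen ?_
      filter_upwards [hdot (act a u₀) u₀, hact a u₀, hu₀'] with x h1 h2 h3
      rw [h1, h2, real_inner_smul_left, real_inner_self_eq_norm_sq, h3]
      simp
    · refine H2N.ext_of_val hΩ.isOpen ?_
      filter_upwards [hact (dot u₀ u₀) u₀, hdot u₀ u₀, hu₀'] with x h1 h2 h3
      rw [h1, h2, real_inner_self_eq_norm_sq, h3]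
      simp
  have hcomplete : CompleteSpace (H2N Ω Space3) := completeSpace_H2N
  obtain ⟨hsub, htan⟩ := submanifold_of_boundedBilin (E := H2N Ω Space3) (A := H2N Ω ℝ) hdotb hactb
    hsymm hunit
  refine ⟨hsub, fun u₀ hu₀ => (htan u₀ hu₀).trans ?_⟩
  ext u
  constructor
  · intro hu
    have hu' : dot u u₀ = 0 := hu
    have h4 := hdot u u₀
    rw [hu'] at h4
    have h5 : H2N.val (0 : H2N Ω ℝ) =ᵐ[volume.restrict Ω] 0 :=
      Lp.coeFn_zero ℝ 2 (volume.restrict Ω)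
    change ∀ᵐ x ∂volume.restrict Ω, inner ℝ (H2N.val u x) (H2N.val u₀ x) = 0
    filter_upwards [h4, h5] with x h6 h7
    rw [← h6, h7, Pi.zero_apply]
  · intro hu
    have hu' : ∀ᵐ x ∂volume.restrict Ω, inner ℝ (H2N.val u x) (H2N.val u₀ x) = 0 := hu
    have h5 : H2N.val (0 : H2N Ω ℝ) =ᵐ[volume.restrict Ω] 0 :=
      Lp.coeFn_zero ℝ 2 (volume.restrict Ω)
    change dot u u₀ = 0
    refine H2N.ext_of_val hΩ.isOpen ?_
    filter_upwards [hdot u u₀, hu', h5] with x h6 h7 h8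
    rw [h6, h7, h8, Pi.zero_apply]
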